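/- Let $0<\theta_0<\pi/2$. There is $R_0>0$ such that for every $R\ge R_0$ there are $T>0$, $r_0>0$ and a smooth function $r:[-\pi/2,\pi/2]\times\mathbb{R}\to\mathbb{R}$, $(\theta,t)\mapsto r(\theta,t)$, with the following properties. (A) Boundary conditions: 1. $r$ is constant in $t$ for $t<-T$ and for $t>T$; 2. $r(\theta,t)=r_0$ whenever $\theta\le\theta_0$ or $t\le -T$; 3. for some $\varepsilon_1>0$, $r$ is constant in $\theta$ for $\theta\ge \pi/2-\varepsilon_1$; 4. $r(\pi/2,t)<0$ for $t>T$; 5. $r$ is non-increasing in $\theta$ and in $t$; 6. there is no $(\theta,t)$ at which $r$, $r_\theta$ and $r_t$ all vanish. (B) Let $X\subset\mathbb{R}^6$, with coordinates $(x,y,z,u,w,t)$, be the set cut out by $$x^2+y^2+z^2=R^2,\qquad u^2+w^2=r(\theta,t),\qquad \theta=\arctan\bigl(z/\sqrt{x^2+y^2}\bigr)$$ ($\theta=\pm\pi/2$ at the poles $x=y=0$). Then $X$ is a smooth embedded $4$-dimensional submanifold, and the Riemannian metric induced on it by the Euclidean metric of $\mathbb{R}^6$ has positive scalar curvature at every point.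 (C) $X$ is cylindrical at both ends and outside the cap $\{\theta>\theta_0\}$: for $t\le -T$, and likewise over $\{\theta\le\theta_0\}$ for all $t$, it is given by $x^2+y^2+z^2=R^2$, $u^2+w^2=r_0$; and for $t>T$ the slice of $X$ at time $t$ does not depend on $t$. (D) Let $W$ be the part of $X$ with $\theta\ge\theta_0$ and $-T\le t\le T$. It is a $2$-handle attached along $S^1\times(\text{polar cap})$: there is a homeomorphism $\Phi:D^2\times D^2\to W$, where $D^2$ is the closed unit disk, such that $\Phi(\partial D^2\times D^2)$ is the part of $W$ where $t=-T$ or $\theta=\theta_0$ (the bottom $S^1\times\text{cap}$ together with the time-constant vertical side), $\Phi(D^2\times\partial D^2)$ is the top, i.e. the part of $W$ where $t=T$, and for $a\in\partial D^2$, $b\in D^2$ the $(u,w)$-coordinates of $\Phi(a,b)$ are $\sqrt{r_0}\,a$, while its $(x,y,z,t)$-coordinates depend only on $b$ (the product framing). -/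

import Mathlib

open scoped ContDiff

noncomputable section

namespace PSCHandle

/-! ### Scalar curvature in coordinates -/

/-- The partial derivative `∂ f / ∂ xᵢ` at `x`. -/
def pd {n : ℕ} (f : (Fin n → ℝ) → ℝ) (i : Fin n) (x : Fin n → ℝ) : ℝ :=
  fderiv ℝ f x (Pi.single i 1)

/-- The Christoffel symbol `Γ^k_{ij}` of the metric `g`. -/
def christoffel {n : ℕ} (g : (Fin n → ℝ) → Matrix (Fin n) (Fin n) ℝ)
    (k i j : Fin n) (x : Fin n → ℝ) : ℝ :=
  ∑ m, (1 / 2 : ℝ) * (g x)⁻¹ k m *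
    (pd (fun y => g y i m) j x + pd (fun y => g y j m) i x - pd (fun y => g y i j) m x)

/-- The component `R^ρ_{σμν}` of the Riemann curvature tensor of the metric `g`. -/
def riemann {n : ℕ} (g : (Fin n → ℝ) → Matrix (Fin n) (Fin n) ℝ)
    (ρ σ μ ν : Fin n) (x : Fin n → ℝ) : ℝ :=
  pd (christoffel g ρ ν σ) μ x - pd (christoffel g ρ μ σ) ν x
    + ∑ l, (christoffel g ρ μ l x * christoffel g l ν σ x
        - christoffel g ρ ν l x * christoffel g l μ σ x)

/-- The Ricci tensor `Ric_{ij} = ∑ₖ R^k_{ikj}`. -/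
def ricci {n : ℕ} (g : (Fin n → ℝ) → Matrix (Fin n) (Fin n) ℝ)
    (i j : Fin n) (x : Fin n → ℝ) : ℝ :=
  ∑ k, riemann g k i k j x

/-- The scalar curvature `∑ g^{ij} Ric_{ij}`. -/
def scalarCurvature {n : ℕ} (g : (Fin n → ℝ) → Matrix (Fin n) (Fin n) ℝ)
    (x : Fin n → ℝ) : ℝ :=
  ∑ i, ∑ j, (g x)⁻¹ i j * ricci g i j x

/-! ### Submanifolds of Euclidean space and their induced metric -/

/-- `ψ`, restricted to the open set `U ⊆ ℝⁿ`, is a smooth local parametrization of `X`: a smooth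
immersion that is a homeomorphism onto a relatively open subset of `X`. -/
structure IsLocalParametrization {n N : ℕ} (X : Set (EuclideanSpace ℝ (Fin N)))
    (U : Set (Fin n → ℝ)) (ψ : (Fin n → ℝ) → EuclideanSpace ℝ (Fin N)) : Prop where
  isOpen : IsOpen U
  smooth : ContDiffOn ℝ ∞ ψ U
  immersion : ∀ x ∈ U, Function.Injective (fderiv ℝ ψ x)
  isEmbedding : Topology.IsEmbedding (fun x : U => ψ x)
  image_eq : ∃ V : Set (EuclideanSpace ℝ (Fin N)), IsOpen V ∧ ψ '' U = X ∩ V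

/-- The metric `g_{ij} = ⟨∂ᵢ ψ, ∂ⱼ ψ⟩` that the ambient Euclidean space induces in the
coordinates given by `ψ`. -/
def inducedMetric {n N : ℕ} (ψ : (Fin n → ℝ) → EuclideanSpace ℝ (Fin N)) (x : Fin n → ℝ) :
    Matrix (Fin n) (Fin n) ℝ :=
  fun i j => inner ℝ (fderiv ℝ ψ x (Pi.single i 1)) (fderiv ℝ ψ x (Pi.single j 1))

/-- `X` is a smooth embedded `n`-dimensional submanifold of `ℝᴺ` whose induced Riemannian metric
has positive scalar curvature: around every point `X` has a smooth local parametrization, in which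
the scalar curvature of the induced metric at that point is positive. (The scalar curvature at a
point does not depend on the local parametrization in which it is computed.) -/
def IsSubmanifoldWithPSC (n : ℕ) {N : ℕ} (X : Set (EuclideanSpace ℝ (Fin N))) : Prop :=
  ∀ p ∈ X, ∃ (U : Set (Fin n → ℝ)) (ψ : (Fin n → ℝ) → EuclideanSpace ℝ (Fin N)),
    IsLocalParametrization X U ψ ∧
      ∃ x ∈ U, ψ x = p ∧ 0 < scalarCurvature (inducedMetric ψ) x

/-! ### The cobordism cut out by a function `r (θ, t)` -/

/-- The latitude `θ = arctan (z / √(x² + y²))` of a point `(x, y, z, u, w, t)` of `ℝ⁶`, written with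
`arcsin` so that it is `±π/2` over the poles. -/
def latitude (p : EuclideanSpace ℝ (Fin 6)) : ℝ :=
  Real.arcsin (p 2 / √(p 0 ^ 2 + p 1 ^ 2 + p 2 ^ 2))

theorem latitude_eq_arctan (p : EuclideanSpace ℝ (Fin 6)) (h : 0 < p 0 ^ 2 + p 1 ^ 2) :
    latitude p = Real.arctan (p 2 / √(p 0 ^ 2 + p 1 ^ 2)) := by
  rw [latitude, Real.arctan_eq_arcsin]
  congr 1
  have h0 : 0 < √(p 0 ^ 2 + p 1 ^ 2) := Real.sqrt_pos.2 h
  have h1 : √(1 + (p 2 / √(p 0 ^ 2 + p 1 ^ 2)) ^ 2)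
      = √(p 0 ^ 2 + p 1 ^ 2 + p 2 ^ 2) / √(p 0 ^ 2 + p 1 ^ 2) := by
    rw [← Real.sqrt_div' _ h.le, div_pow, Real.sq_sqrt h.le]
    congr 1
    field_simp
  rw [h1]
  field_simp

/-- The subset of `ℝ⁶`, with coordinates `(x, y, z, u, w, t)`, cut out by the equations
`x² + y² + z² = R²` and `u² + w² = r (θ, t)`. -/
def cobordism (R : ℝ) (r : ℝ → ℝ → ℝ) : Set (EuclideanSpace ℝ (Fin 6)) :=
  {p | p 0 ^ 2 + p 1 ^ 2 + p 2 ^ 2 = R ^ 2 ∧ p 3 ^ 2 + p 4 ^ 2 = r (latitude p) (p 5)}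

/-- The range `[-π/2, π/2]` of the latitude. -/
def latitudes : Set ℝ := Set.Icc (-(Real.pi / 2)) (Real.pi / 2)

/-- The boundary conditions on the function `r (θ, t)`, `θ ∈ [-π/2, π/2]`, `t ∈ ℝ`. The function is
given as the restriction of a smooth function on the plane. The number `r₀` is the constant
value of `r` for `θ ≤ θ₀` or `t ≤ -T`, the square of the radius of the circle factor there. -/
structure BoundaryConditions (θ₀ T r₀ : ℝ) (r : ℝ → ℝ → ℝ) : Prop where
  smooth : ContDiff ℝ ∞ (fun q : ℝ × ℝ => r q.1 q.2)
  radius_pos : 0 < r₀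
  const_before : ∀ θ ∈ latitudes, ∀ t t', t < -T → t' < -T → r θ t = r θ t'
  const_after : ∀ θ ∈ latitudes, ∀ t t', T < t → T < t' → r θ t = r θ t'
  const_outside : ∀ θ ∈ latitudes, ∀ t, θ ≤ θ₀ ∨ t ≤ -T → r θ t = r₀
  const_near_pole : ∃ ε > 0, ∀ θ ∈ latitudes, ∀ θ' ∈ latitudes,
    Real.pi / 2 - ε ≤ θ → Real.pi / 2 - ε ≤ θ' → ∀ t, r θ t = r θ' t
  neg_at_pole : ∀ t, T < t → r (Real.pi / 2) t < 0
  antitone_latitude : ∀ t, AntitoneOn (fun θ => r θ t) latitudes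
  antitone_time : ∀ θ ∈ latitudes, Antitone (fun t => r θ t)
  nondegenerate : ∀ θ ∈ latitudes, ∀ t,
    ¬ (deriv (fun s => r θ s) t = 0 ∧ deriv (fun s => r s t) θ = 0 ∧ r θ t = 0)

/-- `X` is a product in the time direction for `t ≤ -T`, where it is `S²_R × S¹ × (-∞, -T]` with a
circle of radius `√r₀`, likewise over the complement of the polar cap `θ > θ₀`, and it is
a product in the time direction for `t > T`. -/
def HasCylindricalEnds (R θ₀ T r₀ : ℝ) (X : Set (EuclideanSpace ℝ (Fin 6))) : Prop :=
  (∀ p : EuclideanSpace ℝ (Fin 6), p 5 ≤ -T ∨ latitude p ≤ θ₀ →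
    (p ∈ X ↔ p 0 ^ 2 + p 1 ^ 2 + p 2 ^ 2 = R ^ 2 ∧ p 3 ^ 2 + p 4 ^ 2 = r₀)) ∧
  (∀ p q : EuclideanSpace ℝ (Fin 6), (∀ i, i ≠ 5 → p i = q i) → T < p 5 → T < q 5 →
    (p ∈ X ↔ q ∈ X))

/-- The closed unit disk `D²`. -/
abbrev Disk : Type := Metric.closedBall (0 : EuclideanSpace ℝ (Fin 2)) 1

/-- The part of `X` over the closed polar cap `θ ≥ θ₀` and over times `-T ≤ t ≤ T`. -/
def overCap (θ₀ T : ℝ) (X : Set (EuclideanSpace ℝ (Fin 6))) : Set (EuclideanSpace ℝ (Fin 6)) :=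
  {p | p ∈ X ∧ θ₀ ≤ latitude p ∧ -T ≤ p 5 ∧ p 5 ≤ T}

/-- The part of `X` over the polar cap and over times `-T ≤ t ≤ T` is a 2-handle `D² × D²`. Its
attaching part `∂D² × D²` is the bottom `t = -T`, which is `S¹ × (polar cap)`, together with the
vertical side `θ = θ₀`, which is constant in time; on it the identification respects the
projections to the circle factor and to the cap (product framing). The other part
`D² × ∂D²` of the boundary is the top `t = T`. -/
def IsTwoHandleOverCap (θ₀ T r₀ : ℝ) (X : Set (EuclideanSpace ℝ (Fin 6))) : Prop :=
  ∃ Φ : Disk × Disk ≃ₜ overCap θ₀ T X,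
    (∀ a b : Disk, ‖a.1‖ = 1 ↔ (Φ (a, b)).1 5 = -T ∨ latitude (Φ (a, b)).1 = θ₀) ∧
    (∀ a b : Disk, ‖b.1‖ = 1 ↔ (Φ (a, b)).1 5 = T) ∧
    (∀ a b : Disk, ‖a.1‖ = 1 →
      (Φ (a, b)).1 3 = √r₀ * a.1 0 ∧ (Φ (a, b)).1 4 = √r₀ * a.1 1) ∧
    (∀ a a' b : Disk, ‖a.1‖ = 1 → ‖a'.1‖ = 1 →
      ∀ i : Fin 6, i ≠ 3 → i ≠ 4 → (Φ (a, b)).1 i = (Φ (a', b)).1 i)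

end PSCHandle

end

noncomputable section

namespace PSCHandle

open Filter Topology
open scoped InnerProductSpace

/-! ### Scalar curvature of a graph over its tangent space -/

/-! The set X bounds the region {u² + w² ≤ r}, a thin neighbourhood of the part of S²_R × ℝ where r
≥ 0. Let E be `expNegInvGlue`, s = sin θ₀, and α the affine function of the height z equal to 1 at θ
= θ₀ and to -1 at the pole. The profile is r = η (1 - E(D/δ) / E(1/4)) with depth D = E(1) - E(α(z))
- E(1/2 - t), so T = 1/2 and r₀ = η. Where D ≤ 0 it is the constant η, and r ≥ 0 exactly when D ≤
δ/4. Near the pole and for t ≥ 1/2 both subtracted terms vanish and D = E(1) > δ/4, so r < 0.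

Curvature: the Gauss equation `exists_parametrization_scalarCurvature` writes the scalar curvature
as a positive multiple of `curvatureNumerator`, a polynomial in r and its derivatives. Put dr = -p
dD, so that Hess r = -q dD² - p Hess D. The leading terms are 4 p² |∇D|² and 8 r q |∇D|². The terms
of unknown sign either carry an extra small factor p or r, or are 8 r p ΔD. Three facts make the
leading terms win (`curvature_estimate`): |∇D| is bounded below for 0 < D ≤ E(1)/2
(`exists_depth_gradient_bound`); E' ≤ E'' on x ≤ 1/4, which gives p ≤ δ q
(`glueDeriv_le_glueDeriv₂`); and p and r are small with η. Hence δ is chosen first, then η. Nothing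
requires R to be large.

Handle: use x = `capRadius` and y = 1/2 - t in the unit square, and H = r/η. The region H ≥ 0 avoids
a neighbourhood of the origin, which is the pole at the final time. On each ray from the origin,
max(x, y)² H increases strictly from 0 on H = 0 to 1 on the sides x = 1 and y = 1. The direction
x/(x + y) becomes ‖b‖² and max(x, y)² H becomes ‖a‖². H alone would not do, since it already equals
1 on part of the open square. The result is a continuous bijection from a compact space to D² × D²
(`handleHomeomorph`). -/

theorem hasFDerivAt_mul_of_continuousAt {E : Type*} [NormedAddCommGroup E] [NormedSpace ℝ E]
    {u v : E → ℝ} {v' : E →L[ℝ] ℝ} {x : E} (hu : ContinuousAt u x) (hv : HasFDerivAt v v' x)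
    (hv0 : v x = 0) : HasFDerivAt (fun y => u y * v y) (u x • v') x := by
  have h1 : HasFDerivAt (fun y => u x * v y) (u x • v') x := hv.const_mul (u x)
  have h2 : HasFDerivAt (fun y => (u y - u x) * v y) (0 : E →L[ℝ] ℝ) x := by
    have hO : v =O[𝓝 x] fun y => y - x := by simpa [hv0] using hv.isBigO_sub
    have ho : (fun y => u y - u x) =o[𝓝 x] fun _ => (1 : ℝ) := by
      rw [Asymptotics.isLittleO_one_iff]
      simpa using (hu.tendsto.sub_const (u x))
    have h3 := ho.mul_isBigO hO.norm_right
    rw [hasFDerivAt_iff_isLittleO]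
    simpa [hv0] using h3
  convert! h1.add h2 using 1
  · funext y
    simp only [Pi.add_apply]
    ring
  · simp

theorem hasFDerivAt_mul_of_eq_zero {E : Type*} [NormedAddCommGroup E] [NormedSpace ℝ E]
    {u v : E → ℝ} {x : E} (hu : ContinuousAt u x) (hv : DifferentiableAt ℝ v x)
    (hv0 : v x = 0) : HasFDerivAt (fun y => u y * v y) (u x • fderiv ℝ v x) x :=
  hasFDerivAt_mul_of_continuousAt hu hv.hasFDerivAt hv0

section Graph

variable {n : ℕ} {κ : Type*} [Fintype κ] {g : (Fin n → ℝ) → Matrix (Fin n) (Fin n) ℝ}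
  {k : κ → Fin n → (Fin n → ℝ) → ℝ} {x₀ : Fin n → ℝ}

theorem eventually_pd_metric (hk : ∀ a i, ContDiffAt ℝ 2 (k a i) x₀)
    (hg : ∀ᶠ x in 𝓝 x₀, ∀ i j, g x i j = (if i = j then 1 else 0) + ∑ a, k a i x * k a j x) :
    ∀ᶠ x in 𝓝 x₀, ∀ i j l, pd (fun y => g y i j) l x =
      ∑ a, (k a i x * pd (k a j) l x + k a j x * pd (k a i) l x) := by
  have hd : ∀ᶠ x in 𝓝 x₀, ∀ a i, DifferentiableAt ℝ (k a i) x := by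
    refine eventually_all.2 fun a => eventually_all.2 fun i => ?_
    filter_upwards [(hk a i).eventually (by simp)] with x hx
    exact hx.differentiableAt (by simp)
  filter_upwards [hg.eventually_nhds, hd] with x hx hdx i j l
  have h1 : (fun y => g y i j) =ᶠ[𝓝 x]
      fun y => (if i = j then 1 else 0) + ∑ a, k a i y * k a j y := hx.mono fun y hy => hy i j
  have h2 : HasFDerivAt (fun y => (if i = j then (1 : ℝ) else 0) + ∑ a, k a i y * k a j y)
      (∑ a, (k a i x • fderiv ℝ (k a j) x + k a j x • fderiv ℝ (k a i) x)) x :=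
    (HasFDerivAt.fun_sum fun a _ =>
      (hdx a i).hasFDerivAt.mul (hdx a j).hasFDerivAt).const_add _
  rw [pd, h1.fderiv_eq, h2.fderiv]
  simp [pd]

/-- Each term of ∂g is a factor ∂k times a factor k vanishing at `x₀`, so the product rule needs
only continuity of ∂k and no second derivative of k appears. This is why the curvature at `x₀` is
quadratic in the first derivatives of k. -/
theorem hasFDerivAt_pd_metric (hk : ∀ a i, ContDiffAt ℝ 2 (k a i) x₀)
    (hk0 : ∀ a i, k a i x₀ = 0)
    (hg : ∀ᶠ x in 𝓝 x₀, ∀ i j, g x i j = (if i = j then 1 else 0) + ∑ a, k a i x * k a j x)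
    (i j l : Fin n) :
    HasFDerivAt (pd (fun y => g y i j) l)
      (∑ a, (pd (k a j) l x₀ • fderiv ℝ (k a i) x₀ + pd (k a i) l x₀ • fderiv ℝ (k a j) x₀))
      x₀ := by
  have hc : ∀ a i, ContinuousAt (pd (k a i) l) x₀ := fun a i =>
    (((hk a i).fderiv_right (m := 0) (by norm_num)).continuousAt.clm_apply continuousAt_const)
  have hdk : ∀ a i, DifferentiableAt ℝ (k a i) x₀ := fun a i =>
    (hk a i).differentiableAt (by simp)
  have h1 : pd (fun y => g y i j) l =ᶠ[𝓝 x₀]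
      fun x => ∑ a, (pd (k a j) l x * k a i x + pd (k a i) l x * k a j x) := by
    filter_upwards [eventually_pd_metric hk hg] with x hx
    rw [hx]
    exact Finset.sum_congr rfl fun a _ => by ring
  refine HasFDerivAt.congr_of_eventuallyEq ?_ h1
  exact HasFDerivAt.fun_sum fun a _ => (hasFDerivAt_mul_of_eq_zero (hc a j) (hdk a i) (hk0 a i)).add
    (hasFDerivAt_mul_of_eq_zero (hc a i) (hdk a j) (hk0 a j))

theorem pd_metric_eq_zero (hk : ∀ a i, ContDiffAt ℝ 2 (k a i) x₀)
    (hk0 : ∀ a i, k a i x₀ = 0)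
    (hg : ∀ᶠ x in 𝓝 x₀, ∀ i j, g x i j = (if i = j then 1 else 0) + ∑ a, k a i x * k a j x)
    (i j l : Fin n) : pd (fun y => g y i j) l x₀ = 0 := by
  rw [(eventually_pd_metric hk hg).self_of_nhds]
  simp [hk0]

theorem metric_eq_one (hk0 : ∀ a i, k a i x₀ = 0)
    (hg : ∀ᶠ x in 𝓝 x₀, ∀ i j, g x i j = (if i = j then 1 else 0) + ∑ a, k a i x * k a j x) :
    g x₀ = 1 := by
  ext i j
  rw [hg.self_of_nhds]
  simp [hk0, Matrix.one_apply]

theorem continuousAt_inv_metric (hk : ∀ a i, ContDiffAt ℝ 2 (k a i) x₀)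
    (hk0 : ∀ a i, k a i x₀ = 0)
    (hg : ∀ᶠ x in 𝓝 x₀, ∀ i j, g x i j = (if i = j then 1 else 0) + ∑ a, k a i x * k a j x)
    (i j : Fin n) : ContinuousAt (fun x => (g x)⁻¹ i j) x₀ := by
  have hgc : ContinuousAt g x₀ := by
    refine continuousAt_pi.2 fun i => continuousAt_pi.2 fun j => ?_
    have h1 : (fun y => g y i j) =ᶠ[𝓝 x₀]
      fun y => (if i = j then 1 else 0) + ∑ a, k a i y * k a j y := hg.mono fun y hy => hy i j
    refine ContinuousAt.congr ?_ h1.symm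
    exact continuousAt_const.add (tendsto_finsetSum _ fun a _ =>
      (hk a i).continuousAt.mul (hk a j).continuousAt)
  have hdet : ContinuousAt (fun x => (g x).det) x₀ :=
    (Continuous.matrix_det continuous_id).continuousAt.comp hgc
  have hadj : ContinuousAt (fun x => (g x).adjugate i j) x₀ :=
    ((Continuous.matrix_adjugate continuous_id).matrix_elem i j).continuousAt.comp hgc
  have h0 : (g x₀).det ≠ 0 := by simp [metric_eq_one hk0 hg]
  have : (fun x => (g x)⁻¹ i j) = fun x => ((g x).det)⁻¹ * (g x).adjugate i j := by
    funext x
    rw [Matrix.inv_def, Ring.inverse_eq_inv', Matrix.smul_apply, smul_eq_mul]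
  rw [this]
  exact (hdet.inv₀ h0).mul hadj

/-- As ∂g vanishes at `x₀`, the inverse metric is never differentiated. Only its value there, the
identity, contributes, and the inner sum collapses to one term. -/
theorem pd_christoffel (hk : ∀ a i, ContDiffAt ℝ 2 (k a i) x₀)
    (hk0 : ∀ a i, k a i x₀ = 0)
    (hg : ∀ᶠ x in 𝓝 x₀, ∀ i j, g x i j = (if i = j then 1 else 0) + ∑ a, k a i x * k a j x)
    (m i j l : Fin n) : pd (christoffel g m i j) l x₀ =
      1 / 2 * ∑ a, (pd (k a m) j x₀ * pd (k a i) l x₀ + pd (k a i) j x₀ * pd (k a m) l x₀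
        + (pd (k a m) i x₀ * pd (k a j) l x₀ + pd (k a j) i x₀ * pd (k a m) l x₀)
        - (pd (k a j) m x₀ * pd (k a i) l x₀ + pd (k a i) m x₀ * pd (k a j) l x₀)) := by
  have hD := hasFDerivAt_pd_metric hk hk0 hg
  have hZ := pd_metric_eq_zero hk hk0 hg
  have h : HasFDerivAt (christoffel g m i j) _ x₀ :=
    HasFDerivAt.fun_sum fun q _ => hasFDerivAt_mul_of_continuousAt
      ((continuousAt_inv_metric hk hk0 hg m q).const_mul (1 / 2 : ℝ))
      (((hD i q j).add (hD j q i)).sub (hD i j q)) (by simp [hZ])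
  rw [pd, h.fderiv, sum_apply, Finset.sum_eq_single m]
  · simp [metric_eq_one hk0 hg, Finset.sum_add_distrib,
      Finset.sum_sub_distrib, pd]
  · intro q _ hq
    simp [metric_eq_one hk0 hg, Matrix.one_apply_ne hq.symm]
  · simp

theorem christoffel_eq_zero (hk : ∀ a i, ContDiffAt ℝ 2 (k a i) x₀)
    (hk0 : ∀ a i, k a i x₀ = 0)
    (hg : ∀ᶠ x in 𝓝 x₀, ∀ i j, g x i j = (if i = j then 1 else 0) + ∑ a, k a i x * k a j x)
    (m i j : Fin n) : christoffel g m i j x₀ = 0 := by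
  simp [christoffel, pd_metric_eq_zero hk hk0 hg]

/-- The scalar curvature, at a point `x₀` where all `k a i` vanish, of the metric
`δᵢⱼ + ∑ₐ k a i * k a j`. -/
theorem scalarCurvature_graph (hk : ∀ a i, ContDiffAt ℝ 2 (k a i) x₀)
    (hk0 : ∀ a i, k a i x₀ = 0)
    (hsymm : ∀ a i j, pd (k a i) j x₀ = pd (k a j) i x₀)
    (hg : ∀ᶠ x in 𝓝 x₀, ∀ i j, g x i j = (if i = j then 1 else 0) + ∑ a, k a i x * k a j x) :
    scalarCurvature g x₀ =
      ∑ a, ((∑ i, pd (k a i) i x₀) ^ 2 - ∑ i, ∑ j, pd (k a i) j x₀ ^ 2) := by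
  have h1 : scalarCurvature g x₀ = ∑ i, ∑ j,
      ∑ a, (pd (k a i) i x₀ * pd (k a j) j x₀ - pd (k a i) j x₀ ^ 2) := by
    rw [scalarCurvature]
    refine Finset.sum_congr rfl fun i _ => ?_
    rw [Finset.sum_eq_single i]
    · rw [metric_eq_one hk0 hg, inv_one, Matrix.one_apply_eq, one_mul, ricci]
      refine Finset.sum_congr rfl fun j _ => ?_
      simp only [riemann, christoffel_eq_zero hk hk0 hg, pd_christoffel hk hk0 hg, mul_zero,
        sub_zero, Finset.sum_const_zero, add_zero]
      rw [← mul_sub, ← Finset.sum_sub_distrib, Finset.mul_sum]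
      refine Finset.sum_congr rfl fun a _ => ?_
      rw [hsymm a j i]
      ring
    · intro j _ hj
      simp [metric_eq_one hk0 hg, Matrix.one_apply_ne hj.symm]
    · simp
  rw [h1]
  simp_rw [Finset.sum_sub_distrib, sq (∑ i, _), Finset.sum_mul_sum]
  congr 1
  · simp_rw [Finset.sum_comm (s := (Finset.univ : Finset κ))]
  · simp_rw [Finset.sum_comm (s := (Finset.univ : Finset κ))]

end Graph

/-! ### The Gauss equation for level sets. -/

section LevelSet

variable {n N : ℕ} {κ : Type*} [Fintype κ] {f : κ → EuclideanSpace ℝ (Fin N) → ℝ}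
  {G : κ → EuclideanSpace ℝ (Fin N) → EuclideanSpace ℝ (Fin N)}
  {p₀ : EuclideanSpace ℝ (Fin N)} {e : OrthonormalBasis (Fin n ⊕ κ) ℝ (EuclideanSpace ℝ (Fin N))}
  {ν : κ → ℝ}

/-- Tangential coordinates at `p₀` together with the defining functions `f`. -/
def levelChart (f : κ → EuclideanSpace ℝ (Fin N) → ℝ) (p₀ : EuclideanSpace ℝ (Fin N))
    (e : OrthonormalBasis (Fin n ⊕ κ) ℝ (EuclideanSpace ℝ (Fin N)))
    (p : EuclideanSpace ℝ (Fin N)) : (Fin n → ℝ) × (κ → ℝ) :=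
  (fun i => ⟪e (Sum.inl i), p - p₀⟫_ℝ, fun a => f a p)

/-- The derivative at `p₀` of `levelChart f p₀ e` when the gradient of `f a` is
`ν a • e (Sum.inr a)`. -/
def levelChartDeriv (e : OrthonormalBasis (Fin n ⊕ κ) ℝ (EuclideanSpace ℝ (Fin N)))
    (ν : κ → ℝ) (hν : ∀ a, ν a ≠ 0) :
    EuclideanSpace ℝ (Fin N) ≃L[ℝ] (Fin n → ℝ) × (κ → ℝ) :=
  LinearEquiv.toContinuousLinearEquiv
    { toFun := fun v => (fun i => ⟪e (Sum.inl i), v⟫_ℝ, fun a => ν a * ⟪e (Sum.inr a), v⟫_ℝ)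
      map_add' := fun u v => by ext <;> simp [inner_add_right, mul_add]
      map_smul' := fun c v => by ext <;> simp [inner_smul_right]; ring
      invFun := fun y => ∑ i, y.1 i • e (Sum.inl i) + ∑ a, ((ν a)⁻¹ * y.2 a) • e (Sum.inr a)
      left_inv := fun v => by
        conv_rhs => rw [← e.sum_repr' v]
        simp [Fintype.sum_sum_type, hν]
      right_inv := fun y => by
        classical
        ext i
        · simp [inner_add_right, inner_sum, inner_smul_right, orthonormal_iff_ite.1 e.orthonormal]
        · simp [inner_add_right, inner_sum, inner_smul_right, orthonormal_iff_ite.1 e.orthonormal,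
            hν] }

theorem contDiff_levelChart (hf : ∀ a, ContDiff ℝ ∞ (f a)) :
    ContDiff ℝ ∞ (levelChart f p₀ e) :=
  (contDiff_pi.2 fun _ => contDiff_const.inner ℝ (contDiff_id.sub contDiff_const)).prodMk
    (contDiff_pi.2 hf)

theorem hasFDerivAt_levelChart (hG : ∀ a p, HasFDerivAt (f a) (innerSL ℝ (G a p)) p)
    (hν : ∀ a, ν a ≠ 0) (hGp : ∀ a, G a p₀ = ν a • e (Sum.inr a)) :
    HasFDerivAt (levelChart f p₀ e) (levelChartDeriv e ν hν : _ →L[ℝ] _) p₀ := by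
  have h1 : HasFDerivAt (fun p => fun i => ⟪e (Sum.inl i), p - p₀⟫_ℝ)
      (ContinuousLinearMap.pi fun i : Fin n => innerSL ℝ (e (Sum.inl i))) p₀ :=
    hasFDerivAt_pi.2 fun i => (innerSL ℝ (e (Sum.inl i))).hasFDerivAt.comp p₀
      ((hasFDerivAt_id p₀).sub_const p₀)
  have h2 : HasFDerivAt (fun p => fun a => f a p)
      (ContinuousLinearMap.pi fun a => innerSL ℝ (G a p₀)) p₀ := hasFDerivAt_pi.2 fun a => hG a p₀
  convert! h1.prodMk h2 using 1
  ext v i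
  · simp [levelChartDeriv]
  · simp [levelChartDeriv, hGp]

/-- A set cut out by equations with orthogonal nonzero gradients at `p₀` is near `p₀` a graph over
its tangent space. -/
theorem exists_graph_parametrization {X : Set (EuclideanSpace ℝ (Fin N))}
    (hX : ∀ p, p ∈ X ↔ ∀ a, f a p = 0) (hp₀ : p₀ ∈ X) (hf : ∀ a, ContDiff ℝ ∞ (f a))
    (hG : ∀ a p, HasFDerivAt (f a) (innerSL ℝ (G a p)) p)
    (hν : ∀ a, ν a ≠ 0) (hGp : ∀ a, G a p₀ = ν a • e (Sum.inr a)) :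
    ∃ (U : Set (Fin n → ℝ)) (ψ : (Fin n → ℝ) → EuclideanSpace ℝ (Fin N)),
      IsLocalParametrization X U ψ ∧ 0 ∈ U ∧ ψ 0 = p₀ ∧
      (∀ x ∈ U, ContDiffAt ℝ ∞ ψ x) ∧ (∀ x ∈ U, ∀ i, ⟪e (Sum.inl i), ψ x - p₀⟫_ℝ = x i) ∧
      ∀ x ∈ U, ∀ a, f a (ψ x) = 0 := by
  set Θ := levelChart f p₀ e with hΘ
  have hΘs : ContDiff ℝ ∞ Θ := contDiff_levelChart hf
  have hΘd := hasFDerivAt_levelChart (e := e) hG hν hGp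
  let φ := hΘs.contDiffAt.toOpenPartialHomeomorph Θ hΘd (by simp)
  have hφ : ∀ p, φ p = Θ p := fun _ => rfl
  have hps : p₀ ∈ φ.source := hΘs.contDiffAt.mem_toOpenPartialHomeomorph_source hΘd (by simp)
  -- The local inverse of Θ is smooth at points where the derivative of Θ is invertible; O is the
  -- open set of such points, and U is cut down to it.
  let O : Set (EuclideanSpace ℝ (Fin N)) := fderiv ℝ Θ ⁻¹'
    Set.range ((↑) : (EuclideanSpace ℝ (Fin N) ≃L[ℝ] (Fin n → ℝ) × (κ → ℝ)) → _)
  have hO : IsOpen O := ContinuousLinearEquiv.isOpen.preimage (hΘs.continuous_fderiv (by simp))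
  have hpO : p₀ ∈ O := ⟨levelChartDeriv e ν hν, hΘd.fderiv.symm⟩
  have hΘp : Θ p₀ = (0, 0) := by
    ext i
    · simp [hΘ, levelChart]
    · exact (hX p₀).1 hp₀ i
  have hc : Continuous fun x : Fin n → ℝ => (x, (0 : κ → ℝ)) := by fun_prop
  let ψ : (Fin n → ℝ) → EuclideanSpace ℝ (Fin N) := fun x => φ.symm (x, 0)
  let U : Set (Fin n → ℝ) := (fun x => (x, (0 : κ → ℝ))) ⁻¹' (φ.target ∩ φ.symm ⁻¹' O)
  have hΘψ : ∀ x ∈ U, Θ (ψ x) = (x, 0) := fun x hx => φ.right_inv hx.1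
  have hψ0 : ψ 0 = p₀ := by
    change φ.symm (0, 0) = p₀
    rw [← hΘp, ← hφ, φ.left_inv hps]
  have hψs : ∀ x ∈ U, ContDiffAt ℝ ∞ ψ x := by
    rintro x ⟨hx, L, hL⟩
    have h1 : HasFDerivAt φ (L : _ →L[ℝ] _) (φ.symm (x, 0)) := by
      rw [hL]
      exact (hΘs.differentiable (by simp) _).hasFDerivAt
    have h2 : ContDiffAt ℝ ∞ φ.symm (x, 0) := φ.contDiffAt_symm hx h1 hΘs.contDiffAt
    exact h2.comp x (contDiff_id.prodMk contDiff_const).contDiffAt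
  have hcoord : ∀ x ∈ U, ∀ i, ⟪e (Sum.inl i), ψ x - p₀⟫_ℝ = x i := fun x hx i =>
    congrFun (congrArg Prod.fst (hΘψ x hx)) i
  have hUo : IsOpen U := (φ.symm.isOpen_inter_preimage hO).preimage hc
  refine ⟨U, ψ, ⟨hUo, fun x hx => (hψs x hx).contDiffWithinAt, ?_, ?_, φ.source ∩ O,
    φ.open_source.inter hO, ?_⟩, ?_, hψ0, hψs, hcoord,
    fun x hx a => congrFun (congrArg Prod.snd (hΘψ x hx)) a⟩
  · intro x hx u v huv
    have hd := ((hψs x hx).differentiableAt (by simp)).hasFDerivAt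
    have h3 : ∀ w : Fin n → ℝ, ∀ i, ⟪e (Sum.inl i), fderiv ℝ ψ x w⟫_ℝ = w i := by
      intro w i
      have h4 : HasFDerivAt (fun y => ⟪e (Sum.inl i), ψ y - p₀⟫_ℝ)
          ((innerSL ℝ (e (Sum.inl i))).comp (fderiv ℝ ψ x)) x :=
        (innerSL ℝ (e (Sum.inl i))).hasFDerivAt.comp x (hd.sub_const p₀)
      have h5 : HasFDerivAt (fun y => ⟪e (Sum.inl i), ψ y - p₀⟫_ℝ)
          (ContinuousLinearMap.proj (R := ℝ) (φ := fun _ => ℝ) i) x :=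
        (ContinuousLinearMap.proj (R := ℝ) (φ := fun _ => ℝ) i).hasFDerivAt.congr_of_eventuallyEq
          ((hUo.eventually_mem hx).mono fun y hy => hcoord y hy i)
      simpa using DFunLike.congr_fun (h4.unique h5) w
    funext i
    rw [← h3 u i, ← h3 v i, huv]
  · refine Topology.IsEmbedding.of_comp
      (continuousOn_iff_continuous_domRestrict.1 fun x hx => (hψs x hx).continuousAt.continuousWithinAt)
      (g := fun p => (Θ p).1) (hΘs.continuous.fst) ?_
    convert! Topology.IsEmbedding.subtypeVal (p := (· ∈ U)) using 1
    funext x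
    exact congrArg Prod.fst (hΘψ x x.2)
  · ext p
    constructor
    · rintro ⟨x, hx, rfl⟩
      refine ⟨(hX _).2 fun a => congrFun (congrArg Prod.snd (hΘψ x hx)) a, φ.map_target hx.1, hx.2⟩
    · rintro ⟨hpX, hp1, hp2⟩
      have h6 : ((Θ p).1, (0 : κ → ℝ)) = φ p := by
        classical
        ext i
        · rfl
        · exact ((hX p).1 hpX i).symm
      refine ⟨(Θ p).1, ⟨?_, ?_⟩, ?_⟩
      · change ((Θ p).1, (0 : κ → ℝ)) ∈ φ.target
        rw [h6]
        exact φ.map_source hp1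
      · change φ.symm ((Θ p).1, (0 : κ → ℝ)) ∈ O
        rwa [h6, φ.left_inv hp1]
      · change φ.symm ((Θ p).1, (0 : κ → ℝ)) = p
        rw [h6, φ.left_inv hp1]
  · refine ⟨?_, ?_⟩
    · change ((0 : Fin n → ℝ), (0 : κ → ℝ)) ∈ φ.target
      rw [← hΘp]
      exact φ.map_source hps
    · change ψ 0 ∈ O
      rwa [hψ0]

/-- The Gauss equation for a set cut out by equations `f a = 0` whose gradients `G a` at `p₀` are
orthogonal and nonzero, and whose Hessians at `p₀` are `A a`. -/
theorem exists_parametrization_scalarCurvature {X : Set (EuclideanSpace ℝ (Fin N))}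
    {A : κ → EuclideanSpace ℝ (Fin N) →L[ℝ] EuclideanSpace ℝ (Fin N)}
    (hX : ∀ p, p ∈ X ↔ ∀ a, f a p = 0) (hp₀ : p₀ ∈ X) (hf : ∀ a, ContDiff ℝ ∞ (f a))
    (hG : ∀ a p, HasFDerivAt (f a) (innerSL ℝ (G a p)) p)
    (hA : ∀ a, HasFDerivAt (G a) (A a) p₀)
    (hAs : ∀ a u v, ⟪A a u, v⟫_ℝ = ⟪u, A a v⟫_ℝ)
    (hν : ∀ a, ν a ≠ 0) (hGp : ∀ a, G a p₀ = ν a • e (Sum.inr a)) :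
    ∃ (U : Set (Fin n → ℝ)) (ψ : (Fin n → ℝ) → EuclideanSpace ℝ (Fin N)),
      IsLocalParametrization X U ψ ∧ ∃ x ∈ U, ψ x = p₀ ∧
      scalarCurvature (inducedMetric ψ) x = ∑ a, ((ν a) ^ 2)⁻¹ *
        ((∑ i, ⟪A a (e (Sum.inl i)), e (Sum.inl i)⟫_ℝ) ^ 2
          - ∑ i, ∑ j, ⟪A a (e (Sum.inl i)), e (Sum.inl j)⟫_ℝ ^ 2) := by
  obtain ⟨U, ψ, hψ, h0, hψ0, hs, hc, hz⟩ := exists_graph_parametrization hX hp₀ hf hG hν hGp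
  refine ⟨U, ψ, hψ, 0, h0, hψ0, ?_⟩
  let J : Fin n → (Fin n → ℝ) → EuclideanSpace ℝ (Fin N) :=
    fun j x => fderiv ℝ ψ x (Pi.single j 1)
  have hd : ∀ x ∈ U, HasFDerivAt ψ (fderiv ℝ ψ x) x := fun x hx =>
    ((hs x hx).differentiableAt (by simp)).hasFDerivAt
  have hJ : ∀ x ∈ U, ∀ i j, ⟪e (Sum.inl i), J j x⟫_ℝ = if i = j then 1 else 0 := by
    intro x hx i j
    have h4 : HasFDerivAt (fun y => ⟪e (Sum.inl i), ψ y - p₀⟫_ℝ)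
        ((innerSL ℝ (e (Sum.inl i))).comp (fderiv ℝ ψ x)) x :=
      (innerSL ℝ (e (Sum.inl i))).hasFDerivAt.comp x ((hd x hx).sub_const p₀)
    have h5 : HasFDerivAt (fun y => ⟪e (Sum.inl i), ψ y - p₀⟫_ℝ)
        (ContinuousLinearMap.proj (R := ℝ) (φ := fun _ => ℝ) i) x :=
      (ContinuousLinearMap.proj (R := ℝ) (φ := fun _ => ℝ) i).hasFDerivAt.congr_of_eventuallyEq
        ((hψ.isOpen.eventually_mem hx).mono fun y hy => hc y hy i)
    simpa [Pi.single_apply] using DFunLike.congr_fun (h4.unique h5) (Pi.single j 1)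
  have hGJ : ∀ x ∈ U, ∀ a j, ⟪G a (ψ x), J j x⟫_ℝ = 0 := by
    intro x hx a j
    have h4 : HasFDerivAt (fun y => f a (ψ y)) ((innerSL ℝ (G a (ψ x))).comp (fderiv ℝ ψ x)) x :=
      (hG a (ψ x)).comp x (hd x hx)
    have h5 : HasFDerivAt (fun y => f a (ψ y)) (0 : (Fin n → ℝ) →L[ℝ] ℝ) x :=
      (hasFDerivAt_const (0 : ℝ) x).congr_of_eventuallyEq
        ((hψ.isOpen.eventually_mem hx).mono fun y hy => hz y hy a)
    simpa using DFunLike.congr_fun (h4.unique h5) (Pi.single j 1)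
  -- The normal components of ∂ⱼψ. The tangential ones are constant, so the metric is 1 + ∑ k k, and
  -- the derivative of k at 0 is the second fundamental form.
  let k : κ → Fin n → (Fin n → ℝ) → ℝ := fun a j x => ⟪e (Sum.inr a), J j x⟫_ℝ
  have hJs : ∀ j, ContDiffAt ℝ 2 (J j) 0 := fun j =>
    ((hs 0 h0).fderiv_right (m := 2) (by norm_cast)).clm_apply contDiffAt_const
  have hk : ∀ a j, ContDiffAt ℝ 2 (k a j) 0 := fun a j => contDiffAt_const.inner ℝ (hJs j)
  have hk0 : ∀ a j, k a j 0 = 0 := by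
    intro a j
    have := hGJ 0 h0 a j
    rw [hψ0, hGp, inner_smul_left] at this
    simpa [hν a] using this
  have hJ0 : ∀ j, J j 0 = e (Sum.inl j) := by
    intro j
    rw [← e.sum_repr' (J j 0), Fintype.sum_sum_type]
    have h1 : ∀ a, ⟪e (Sum.inr a), J j 0⟫_ℝ = 0 := fun a => hk0 a j
    simp [hJ 0 h0, h1]
  -- Differentiating ⟨∇f, ∂ᵢψ⟩ = 0 at 0 gives ν ∂ⱼk + Hess f (eᵢ, eⱼ) = 0.
  have hpd : ∀ a i j, pd (k a i) j 0 = -(ν a)⁻¹ * ⟪A a (e (Sum.inl i)), e (Sum.inl j)⟫_ℝ := by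
    intro a i j
    have hJd : HasFDerivAt (J i) (fderiv ℝ (J i) 0) 0 :=
      ((hJs i).differentiableAt (by simp)).hasFDerivAt
    have h1 : HasFDerivAt (k a i) ((innerSL ℝ (e (Sum.inr a))).comp (fderiv ℝ (J i) 0)) 0 :=
      (innerSL ℝ (e (Sum.inr a))).hasFDerivAt.comp 0 hJd
    have hGd : HasFDerivAt (fun x => G a (ψ x)) ((A a).comp (fderiv ℝ ψ 0)) 0 := by
      refine HasFDerivAt.comp 0 ?_ (hd 0 h0)
      rw [hψ0]
      exact hA a
    have h2 := hGd.inner ℝ hJd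
    have h3 : HasFDerivAt (fun x => ⟪G a (ψ x), J i x⟫_ℝ) (0 : (Fin n → ℝ) →L[ℝ] ℝ) 0 :=
      (hasFDerivAt_const (0 : ℝ) _).congr_of_eventuallyEq
        ((hψ.isOpen.eventually_mem h0).mono fun y hy => hGJ y hy a i)
    have h4 := DFunLike.congr_fun (h2.unique h3) (Pi.single j 1)
    have h5 : ⟪ν a • e (Sum.inr a), fderiv ℝ (J i) 0 (Pi.single j 1)⟫_ℝ
        + ⟪A a (J j 0), J i 0⟫_ℝ = 0 := by
      simpa [hψ0, hGp] using h4
    rw [hJ0, hJ0, inner_smul_left] at h5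
    rw [pd, h1.fderiv, hAs, real_inner_comm]
    simp only [ContinuousLinearMap.comp_apply, innerSL_apply_apply]
    simp only [conj_trivial] at h5
    have := hν a
    field_simp
    linarith
  have hsymm : ∀ a i j, pd (k a i) j 0 = pd (k a j) i 0 := by
    intro a i j
    rw [hpd, hpd, hAs, real_inner_comm]
  have hg : ∀ᶠ x in 𝓝 (0 : Fin n → ℝ), ∀ i j, inducedMetric ψ x i j =
      (if i = j then 1 else 0) + ∑ a, k a i x * k a j x := by
    filter_upwards [hψ.isOpen.eventually_mem h0] with x hx i j
    change ⟪J i x, J j x⟫_ℝ = _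
    rw [← e.sum_inner_mul_inner, Fintype.sum_sum_type]
    congr 1
    · simp_rw [real_inner_comm (e _) (J i x), hJ x hx]
      simp [eq_comm]
    · simp_rw [real_inner_comm (e _) (J i x)]
      rfl
  rw [scalarCurvature_graph hk hk0 hsymm hg]
  refine Finset.sum_congr rfl fun a _ => ?_
  simp_rw [hpd, ← Finset.mul_sum, mul_pow, ← Finset.mul_sum]
  rw [neg_sq, inv_pow]
  ring

end LevelSet

/-! ### Tangential traces from ambient traces and normal vectors. -/

section Trace

variable {E ι ι' κ : Type*} [NormedAddCommGroup E] [InnerProductSpace ℝ E] [Fintype ι] [Fintype ι']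
  [Fintype κ] {A : E →L[ℝ] E}

theorem sum_inner_apply_self_eq (e : OrthonormalBasis ι ℝ E) (b : OrthonormalBasis ι' ℝ E) :
    ∑ i, ⟪A (e i), e i⟫_ℝ = ∑ i, ⟪A (b i), b i⟫_ℝ := by
  simp_rw [real_inner_comm]
  exact (LinearMap.trace_eq_sum_inner (A : E →ₗ[ℝ] E) e).symm.trans
    (LinearMap.trace_eq_sum_inner (A : E →ₗ[ℝ] E) b)

theorem sum_inner_apply_self_inl (e : OrthonormalBasis (ι ⊕ κ) ℝ E)
    (b : OrthonormalBasis ι' ℝ E) :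
    ∑ i, ⟪A (e (Sum.inl i)), e (Sum.inl i)⟫_ℝ =
      ∑ i, ⟪A (b i), b i⟫_ℝ - ∑ a, ⟪A (e (Sum.inr a)), e (Sum.inr a)⟫_ℝ := by
  rw [← sum_inner_apply_self_eq e b, Fintype.sum_sum_type]
  ring

/-- Split A into tangential, mixed and normal blocks. The sum of |A eₐ|² over normal vectors
contains one mixed and one normal block, so subtracting it twice removes the normal block once too
often. No tangent basis has to be computed. -/
theorem sum_sq_inner_apply_inl (hA : ∀ u v, ⟪A u, v⟫_ℝ = ⟪u, A v⟫_ℝ)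
    (e : OrthonormalBasis (ι ⊕ κ) ℝ E) (b : OrthonormalBasis ι' ℝ E) :
    ∑ i, ∑ j, ⟪A (e (Sum.inl i)), e (Sum.inl j)⟫_ℝ ^ 2 =
      ∑ i, ⟪A (b i), A (b i)⟫_ℝ - 2 * ∑ a, ⟪A (e (Sum.inr a)), A (e (Sum.inr a))⟫_ℝ
        + ∑ a, ∑ c, ⟪A (e (Sum.inr a)), e (Sum.inr c)⟫_ℝ ^ 2 := by
  have h1 : ∑ i, ⟪A (b i), A (b i)⟫_ℝ = ∑ i, ⟪A (e i), A (e i)⟫_ℝ := by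
    have := sum_inner_apply_self_eq (A := A.comp A) b e
    simpa [hA] using this
  have h2 : ∀ u : E, ⟪A u, A u⟫_ℝ = ∑ i, ⟪A u, e (Sum.inl i)⟫_ℝ ^ 2
      + ∑ a, ⟪A u, e (Sum.inr a)⟫_ℝ ^ 2 := fun u => by
    rw [← Fintype.sum_sum_type (fun l => ⟪A u, e l⟫_ℝ ^ 2), e.sum_sq_inner_left,
      real_inner_self_eq_norm_sq]
  have h3 : ∑ i, ∑ a, ⟪A (e (Sum.inl i)), e (Sum.inr a)⟫_ℝ ^ 2
      = ∑ a, ∑ i, ⟪A (e (Sum.inr a)), e (Sum.inl i)⟫_ℝ ^ 2 := by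
    rw [Finset.sum_comm]
    exact Finset.sum_congr rfl fun a _ => Finset.sum_congr rfl fun i _ => by
      rw [hA, real_inner_comm]
  rw [h1, Fintype.sum_sum_type]
  simp_rw [h2, Finset.sum_add_distrib]
  rw [h3]
  ring

end Trace

/-! ### Scalar curvature of a circle bundle over a part of `S² × ℝ` -/

/-- The Hessians of the functions defining the cobordism. -/
def hessianOp (a b c d e : ℝ) : EuclideanSpace ℝ (Fin 6) →L[ℝ] EuclideanSpace ℝ (Fin 6) :=
  LinearMap.toContinuousLinearMap
    { toFun := fun v => !₂[a * v 0, a * v 1, b * v 2 + c * v 5, d * v 3, d * v 4, c * v 2 + e * v 5]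
      map_add' := fun u v => by ext i; fin_cases i <;> simp <;> ring
      map_smul' := fun s v => by ext i; fin_cases i <;> simp <;> ring }

theorem hessianOp_apply (a b c d e : ℝ) (v : EuclideanSpace ℝ (Fin 6)) :
    hessianOp a b c d e v =
      !₂[a * v 0, a * v 1, b * v 2 + c * v 5, d * v 3, d * v 4, c * v 2 + e * v 5] := rfl

theorem inner_eq_sum_six (u v : EuclideanSpace ℝ (Fin 6)) :
    ⟪u, v⟫_ℝ = u 0 * v 0 + u 1 * v 1 + u 2 * v 2 + u 3 * v 3 + u 4 * v 4 + u 5 * v 5 := by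
  simp [PiLp.inner_apply, Fin.sum_univ_six, mul_comm]

theorem inner_hessianOp (a b c d e : ℝ) (u v : EuclideanSpace ℝ (Fin 6)) :
    ⟪hessianOp a b c d e u, v⟫_ℝ = a * (u 0 * v 0 + u 1 * v 1) + b * (u 2 * v 2)
      + c * (u 5 * v 2 + u 2 * v 5) + d * (u 3 * v 3 + u 4 * v 4) + e * (u 5 * v 5) := by
  rw [inner_eq_sum_six, hessianOp_apply]
  simp
  ring

theorem inner_hessianOp_hessianOp (a b c d e : ℝ) (u : EuclideanSpace ℝ (Fin 6)) :
    ⟪hessianOp a b c d e u, hessianOp a b c d e u⟫_ℝ =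
      a ^ 2 * (u 0 ^ 2 + u 1 ^ 2) + (b * u 2 + c * u 5) ^ 2 + d ^ 2 * (u 3 ^ 2 + u 4 ^ 2)
        + (c * u 2 + e * u 5) ^ 2 := by
  rw [inner_eq_sum_six, hessianOp_apply]
  simp
  ring

theorem sum_inner_hessianOp (a b c d e : ℝ) :
    ∑ i, ⟪hessianOp a b c d e (EuclideanSpace.basisFun (Fin 6) ℝ i),
      EuclideanSpace.basisFun (Fin 6) ℝ i⟫_ℝ = 2 * a + b + 2 * d + e := by
  simp [Fin.sum_univ_six, inner_hessianOp]
  ring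

theorem sum_inner_hessianOp_hessianOp (a b c d e : ℝ) :
    ∑ i, ⟪hessianOp a b c d e (EuclideanSpace.basisFun (Fin 6) ℝ i),
      hessianOp a b c d e (EuclideanSpace.basisFun (Fin 6) ℝ i)⟫_ℝ =
      2 * a ^ 2 + b ^ 2 + 2 * c ^ 2 + 2 * d ^ 2 + e ^ 2 := by
  simp_rw [inner_hessianOp_hessianOp]
  simp [Fin.sum_univ_six]
  ring

/-- Up to the factor `2 / N⁴` this is the scalar curvature of `{u² + w² = F (z, t)}` over the sphere
of radius `R`, where `r = F`, `ζ = z² / R²`, `l = F_z z / R²` and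
`N² = F_z² (1 - ζ) + 4 r + F_t²`. -/
def curvatureNumerator (R ζ l r Fz Ft Fzz Fzt Ftt : ℝ) : ℝ :=
  (Fz ^ 2 * (1 - ζ) + 4 * r + Ft ^ 2) * (4 * r + Ft ^ 2) / R ^ 2
    + 4 * (Fz ^ 2 * (1 - ζ) + Ft ^ 2)
    + 8 * r * (2 * l - Fzz * (1 - ζ) - Ftt)
    + 4 * ((2 * l - Fzz * (1 - ζ) - Ftt) * (Fz ^ 2 * (1 - ζ) + Ft ^ 2)
      - ((l - Fzz * (1 - ζ)) * Fz ^ 2 * (1 - ζ) - 2 * Fzt * (1 - ζ) * Fz * Ft - Ftt * Ft ^ 2))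
    + 4 * r * (l * (l - Fzz * (1 - ζ)) - l * Ftt - (l - Fzz * (1 - ζ)) * Ftt - Fzt ^ 2 * (1 - ζ))
    + l * ((l - Fzz * (1 - ζ)) * Ft ^ 2 + 2 * Fzt * (1 - ζ) * Fz * Ft - Ftt * Fz ^ 2 * (1 - ζ))

/-- The left side is the Gauss sum for unit normals u (of the sphere) and v. For the Hessian A of
the second equation, S₁ and S₂/n are ⟨Au, u⟩ and ⟨Av, v⟩, Q₁ and Q₂/n are |Au|² and |Av|², and P/n
is ⟨Au, v⟩². The S₂² terms, of order n⁻³, cancel. -/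
theorem curvatureNumerator_identity {R ζ l r Fz Ft Fzz Fzt Ftt n : ℝ} (hn0 : n ≠ 0)
    (hn : n = Fz ^ 2 * (1 - ζ) + 4 * r + Ft ^ 2)
    {S₁ S₂ Q₁ Q₂ P : ℝ} (hS₁ : S₁ = l - Fzz * ζ)
    (hQ₁ : Q₁ = l ^ 2 + (-2 * l * Fzz + Fzz ^ 2 + Fzt ^ 2) * ζ)
    (hP : P = ζ * (Fzz * Fz * (1 - ζ) + Fzt * Ft) ^ 2)
    (hS₂ : S₂ = l * Fz ^ 2 * (1 - ζ) - Fzz * Fz ^ 2 * (1 - ζ) ^ 2 - 2 * Fzt * Ft * Fz * (1 - ζ)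
      + 8 * r - Ftt * Ft ^ 2)
    (hQ₂ : Q₂ = l ^ 2 * Fz ^ 2 * (1 - ζ) + (Fzz ^ 2 - 2 * l * Fzz) * Fz ^ 2 * (1 - ζ) ^ 2
      - 2 * (l - Fzz) * Fz * (1 - ζ) * Fzt * Ft + Fzt ^ 2 * Ft ^ 2 + 16 * r
      + (Fzt * Fz * (1 - ζ) + Ftt * Ft) ^ 2) :
    (2 - 2 * (Fz ^ 2 * (1 - ζ) / n)) / R ^ 2
      + n⁻¹ * ((2 * l + (l - Fzz) + 2 * 2 + -Ftt - (S₁ + S₂ / n)) ^ 2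
        - (2 * l ^ 2 + (l - Fzz) ^ 2 + 2 * (-Fzt) ^ 2 + 2 * 2 ^ 2 + (-Ftt) ^ 2
          - 2 * (Q₁ + Q₂ / n) + (S₁ ^ 2 + P / n + (P / n + (S₂ / n) ^ 2))))
      = 2 * curvatureNumerator R ζ l r Fz Ft Fzz Fzt Ftt / n ^ 2 := by
  have h1 : (2 - 2 * (Fz ^ 2 * (1 - ζ) / n)) / R ^ 2 = 2 * (n * (4 * r + Ft ^ 2) / R ^ 2) / n ^ 2 := by
    have : Fz ^ 2 * (1 - ζ) = n - 4 * r - Ft ^ 2 := by rw [hn]; ring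
    rw [this]
    field_simp
    ring
  rw [h1, curvatureNumerator, ← hn]
  suffices h : n⁻¹ * ((2 * l + (l - Fzz) + 2 * 2 + -Ftt - (S₁ + S₂ / n)) ^ 2
        - (2 * l ^ 2 + (l - Fzz) ^ 2 + 2 * (-Fzt) ^ 2 + 2 * 2 ^ 2 + (-Ftt) ^ 2
          - 2 * (Q₁ + Q₂ / n) + (S₁ ^ 2 + P / n + (P / n + (S₂ / n) ^ 2)))) =
      2 * (4 * (Fz ^ 2 * (1 - ζ) + Ft ^ 2)
    + 8 * r * (2 * l - Fzz * (1 - ζ) - Ftt)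
    + 4 * ((2 * l - Fzz * (1 - ζ) - Ftt) * (Fz ^ 2 * (1 - ζ) + Ft ^ 2)
      - ((l - Fzz * (1 - ζ)) * Fz ^ 2 * (1 - ζ) - 2 * Fzt * (1 - ζ) * Fz * Ft - Ftt * Ft ^ 2))
    + 4 * r * (l * (l - Fzz * (1 - ζ)) - l * Ftt - (l - Fzz * (1 - ζ)) * Ftt - Fzt ^ 2 * (1 - ζ))
    + l * ((l - Fzz * (1 - ζ)) * Ft ^ 2 + 2 * Fzt * (1 - ζ) * Fz * Ft
      - Ftt * Fz ^ 2 * (1 - ζ))) / n ^ 2 by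
    rw [h]
    ring
  have hr : r = (n - Fz ^ 2 * (1 - ζ) - Ft ^ 2) / 4 := by rw [hn]; ring
  rw [hS₁, hQ₁, hP, hS₂, hQ₂, hr]
  field_simp
  ring

theorem hasFDerivAt_coord {N : ℕ} (i : Fin N) (q : EuclideanSpace ℝ (Fin N)) :
    HasFDerivAt (fun q : EuclideanSpace ℝ (Fin N) => q i)
      (EuclideanSpace.proj (𝕜 := ℝ) i : EuclideanSpace ℝ (Fin N) →L[ℝ] ℝ) q :=
  (EuclideanSpace.proj (𝕜 := ℝ) i : EuclideanSpace ℝ (Fin N) →L[ℝ] ℝ).hasFDerivAt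

theorem hasFDerivAt_comp_coords {H : ℝ → ℝ → ℝ} {a b : ℝ} {q : EuclideanSpace ℝ (Fin 6)}
    (h : HasFDerivAt (fun s : ℝ × ℝ => H s.1 s.2)
      (a • ContinuousLinearMap.fst ℝ ℝ ℝ + b • ContinuousLinearMap.snd ℝ ℝ ℝ) (q 2, q 5)) :
    HasFDerivAt (fun q : EuclideanSpace ℝ (Fin 6) => H (q 2) (q 5))
      (a • (EuclideanSpace.proj (𝕜 := ℝ) 2 : EuclideanSpace ℝ (Fin 6) →L[ℝ] ℝ)
        + b • (EuclideanSpace.proj (𝕜 := ℝ) 5 : EuclideanSpace ℝ (Fin 6) →L[ℝ] ℝ)) q := by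
  have := HasFDerivAt.comp q h ((hasFDerivAt_coord 2 q).prodMk (hasFDerivAt_coord 5 q))
  convert! this using 1

theorem exists_orthonormalBasis_inr {m : ℕ} {u v : EuclideanSpace ℝ (Fin (m + 2))}
    (hu : ⟪u, u⟫_ℝ = 1) (hv : ⟪v, v⟫_ℝ = 1) (huv : ⟪u, v⟫_ℝ = 0) :
    ∃ e : OrthonormalBasis (Fin m ⊕ Fin 2) ℝ (EuclideanSpace ℝ (Fin (m + 2))),
      e (Sum.inr 0) = u ∧ e (Sum.inr 1) = v := by
  let w : Fin m ⊕ Fin 2 → EuclideanSpace ℝ (Fin (m + 2)) := Sum.elim (fun _ => 0) ![u, v]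
  have hw : Orthonormal ℝ ((Set.range (Sum.inr : Fin 2 → Fin m ⊕ Fin 2)).domRestrict w) := by
    rw [orthonormal_iff_ite]
    rintro ⟨_, i, rfl⟩ ⟨_, j, rfl⟩
    fin_cases i <;> fin_cases j <;> simp [w, huv, real_inner_comm] <;>
      first | (simpa using hu) | (simpa using hv)
  obtain ⟨b, hb⟩ := hw.exists_orthonormalBasis_extension_of_card_eq (by simp)
  exact ⟨b, hb _ ⟨0, rfl⟩, hb _ ⟨1, rfl⟩⟩

/-- The circle bundle `u² + w² = F (z, t)`, degenerate where `F = 0`, over the sphere of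
radius `R` times the line. -/
def circleBundle (R : ℝ) (F : ℝ → ℝ → ℝ) : Set (EuclideanSpace ℝ (Fin 6)) :=
  {p | p 0 ^ 2 + p 1 ^ 2 + p 2 ^ 2 = R ^ 2 ∧ p 3 ^ 2 + p 4 ^ 2 = F (p 2) (p 5)}

/-! ### Scalar curvature of the circle bundle at a point. -/

section CircleBundle

variable {R l : ℝ} {F Fz Ft : ℝ → ℝ → ℝ}

/-- Equations for `circleBundle R F`; `l` is chosen so that their gradients are orthogonal. -/
def bundleEquation (R l : ℝ) (F : ℝ → ℝ → ℝ) : Fin 2 → EuclideanSpace ℝ (Fin 6) → ℝ :=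
  ![fun q => q 0 ^ 2 + q 1 ^ 2 + q 2 ^ 2 - R ^ 2,
    fun q => q 3 ^ 2 + q 4 ^ 2 - F (q 2) (q 5) + l / 2 * (q 0 ^ 2 + q 1 ^ 2 + q 2 ^ 2 - R ^ 2)]

/-- The gradients of `bundleEquation`. -/
def bundleGradient (l : ℝ) (Fz Ft : ℝ → ℝ → ℝ) :
    Fin 2 → EuclideanSpace ℝ (Fin 6) → EuclideanSpace ℝ (Fin 6) :=
  ![fun q => !₂[2 * q 0, 2 * q 1, 2 * q 2, 0, 0, 0],
    fun q => !₂[l * q 0, l * q 1, l * q 2 - Fz (q 2) (q 5), 2 * q 3, 2 * q 4, -Ft (q 2) (q 5)]]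

theorem mem_circleBundle_iff (p : EuclideanSpace ℝ (Fin 6)) :
    p ∈ circleBundle R F ↔ ∀ a, bundleEquation R l F a p = 0 := by
  rw [Fin.forall_fin_two]
  simp only [circleBundle, Set.mem_ofPred_eq, bundleEquation, Matrix.cons_val_zero,
    Matrix.cons_val_one]
  constructor
  · rintro ⟨h1, h2⟩
    rw [h1, h2]
    simp
  · rintro ⟨h1, h2⟩
    rw [h1] at h2
    constructor <;> linarith

theorem contDiff_coord {N : ℕ} (i : Fin N) :
    ContDiff ℝ ∞ (fun q : EuclideanSpace ℝ (Fin N) => q i) :=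
  (EuclideanSpace.proj (𝕜 := ℝ) i : EuclideanSpace ℝ (Fin N) →L[ℝ] ℝ).contDiff

theorem contDiff_bundleEquation (hF : ContDiff ℝ ∞ (fun s : ℝ × ℝ => F s.1 s.2)) (a : Fin 2) :
    ContDiff ℝ ∞ (bundleEquation R l F a) := by
  have hc := contDiff_coord (N := 6)
  have h1 : ContDiff ℝ ∞ fun q : EuclideanSpace ℝ (Fin 6) =>
      q 0 ^ 2 + q 1 ^ 2 + q 2 ^ 2 - R ^ 2 :=
    ((((hc 0).pow 2).add ((hc 1).pow 2)).add ((hc 2).pow 2)).sub contDiff_const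
  have h2 : ContDiff ℝ ∞ fun q : EuclideanSpace ℝ (Fin 6) => F (q 2) (q 5) :=
    hF.comp ((hc 2).prodMk (hc 5))
  revert a
  rw [Fin.forall_fin_two]
  exact ⟨h1, ((((hc 3).pow 2).add ((hc 4).pow 2)).sub h2).add (contDiff_const.mul h1)⟩

theorem hasFDerivAt_bundleEquation
    (hd : ∀ s : ℝ × ℝ, HasFDerivAt (fun s : ℝ × ℝ => F s.1 s.2)
      (Fz s.1 s.2 • ContinuousLinearMap.fst ℝ ℝ ℝ + Ft s.1 s.2 • ContinuousLinearMap.snd ℝ ℝ ℝ) s)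
    (a : Fin 2) (q : EuclideanSpace ℝ (Fin 6)) :
    HasFDerivAt (bundleEquation R l F a) (innerSL ℝ (bundleGradient l Fz Ft a q)) q := by
  have hc := fun i => (hasFDerivAt_coord (N := 6) i q).pow 2
  have h1 := (((hc 0).add (hc 1)).add (hc 2)).sub_const (R ^ 2)
  have h2 := hasFDerivAt_comp_coords (hd (q 2, q 5))
  revert a
  rw [Fin.forall_fin_two]
  refine ⟨?_, ?_⟩
  · convert! h1 using 1
    ext v
    simp [bundleGradient, inner_eq_sum_six]
  · convert! (((hc 3).add (hc 4)).sub h2).add (h1.const_mul (l / 2)) using 1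
    ext v
    simp [bundleGradient, inner_eq_sum_six]
    ring

theorem hasFDerivAt_bundleGradient {q : EuclideanSpace ℝ (Fin 6)} {Fzz Fzt Ftt : ℝ}
    (hFz : HasFDerivAt (fun s : ℝ × ℝ => Fz s.1 s.2)
      (Fzz • ContinuousLinearMap.fst ℝ ℝ ℝ + Fzt • ContinuousLinearMap.snd ℝ ℝ ℝ) (q 2, q 5))
    (hFt : HasFDerivAt (fun s : ℝ × ℝ => Ft s.1 s.2)
      (Fzt • ContinuousLinearMap.fst ℝ ℝ ℝ + Ftt • ContinuousLinearMap.snd ℝ ℝ ℝ) (q 2, q 5))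
    (a : Fin 2) :
    HasFDerivAt (bundleGradient l Fz Ft a)
      ((![hessianOp 2 2 0 0 0, hessianOp l (l - Fzz) (-Fzt) 2 (-Ftt)] : Fin 2 → _) a) q := by
  have hc := fun i => (hasFDerivAt_coord (N := 6) i q)
  have hz := hasFDerivAt_comp_coords hFz
  have ht := hasFDerivAt_comp_coords hFt
  revert a
  rw [Fin.forall_fin_two]
  simp only [bundleGradient, Matrix.cons_val_zero, Matrix.cons_val_one]
  constructor
  · rw [← hasFDerivWithinAt_univ, hasFDerivWithinAt_euclidean]
    intro i
    rw [hasFDerivWithinAt_univ]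
    fin_cases i
    · exact HasFDerivAt.congr_fderiv ((hc 0).const_mul 2) (by ext v; simp [hessianOp_apply])
    · exact HasFDerivAt.congr_fderiv ((hc 1).const_mul 2) (by ext v; simp [hessianOp_apply])
    · exact HasFDerivAt.congr_fderiv ((hc 2).const_mul 2) (by ext v; simp [hessianOp_apply])
    · exact HasFDerivAt.congr_fderiv (hasFDerivAt_const (0 : ℝ) q) (by ext v; simp [hessianOp_apply])
    · exact HasFDerivAt.congr_fderiv (hasFDerivAt_const (0 : ℝ) q) (by ext v; simp [hessianOp_apply])
    · exact HasFDerivAt.congr_fderiv (hasFDerivAt_const (0 : ℝ) q) (by ext v; simp [hessianOp_apply])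
  · rw [← hasFDerivWithinAt_univ, hasFDerivWithinAt_euclidean]
    intro i
    rw [hasFDerivWithinAt_univ]
    fin_cases i
    · exact HasFDerivAt.congr_fderiv ((hc 0).const_mul l) (by ext v; simp [hessianOp_apply])
    · exact HasFDerivAt.congr_fderiv ((hc 1).const_mul l) (by ext v; simp [hessianOp_apply])
    · exact HasFDerivAt.congr_fderiv (((hc 2).const_mul l).sub hz) (by ext v; simp [hessianOp_apply]; ring)
    · exact HasFDerivAt.congr_fderiv ((hc 3).const_mul 2) (by ext v; simp [hessianOp_apply])
    · exact HasFDerivAt.congr_fderiv ((hc 4).const_mul 2) (by ext v; simp [hessianOp_apply])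
    · exact HasFDerivAt.congr_fderiv (ht.neg) (by ext v; simp [hessianOp_apply]; ring)

theorem exists_parametrization_circleBundle (hR : 0 < R)
    (hF : ContDiff ℝ ∞ (fun s : ℝ × ℝ => F s.1 s.2))
    (hd : ∀ s : ℝ × ℝ, HasFDerivAt (fun s : ℝ × ℝ => F s.1 s.2)
      (Fz s.1 s.2 • ContinuousLinearMap.fst ℝ ℝ ℝ + Ft s.1 s.2 • ContinuousLinearMap.snd ℝ ℝ ℝ) s)
    {p : EuclideanSpace ℝ (Fin 6)} (hp : p ∈ circleBundle R F) {Fzz Fzt Ftt : ℝ}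
    (hFz : HasFDerivAt (fun s : ℝ × ℝ => Fz s.1 s.2)
      (Fzz • ContinuousLinearMap.fst ℝ ℝ ℝ + Fzt • ContinuousLinearMap.snd ℝ ℝ ℝ) (p 2, p 5))
    (hFt : HasFDerivAt (fun s : ℝ × ℝ => Ft s.1 s.2)
      (Fzt • ContinuousLinearMap.fst ℝ ℝ ℝ + Ftt • ContinuousLinearMap.snd ℝ ℝ ℝ) (p 2, p 5))
    {n : ℝ} (hn : n = Fz (p 2) (p 5) ^ 2 * (1 - p 2 ^ 2 / R ^ 2) + 4 * F (p 2) (p 5)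
      + Ft (p 2) (p 5) ^ 2) (hn0 : 0 < n) :
    ∃ (U : Set (Fin 4 → ℝ)) (ψ : (Fin 4 → ℝ) → EuclideanSpace ℝ (Fin 6)),
      IsLocalParametrization (circleBundle R F) U ψ ∧ ∃ x ∈ U, ψ x = p ∧
      scalarCurvature (inducedMetric ψ) x =
        2 * curvatureNumerator R (p 2 ^ 2 / R ^ 2) (Fz (p 2) (p 5) * p 2 / R ^ 2) (F (p 2) (p 5))
          (Fz (p 2) (p 5)) (Ft (p 2) (p 5)) Fzz Fzt Ftt / n ^ 2 := by
  obtain ⟨hp1, hp2⟩ := id hp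
  set a := Fz (p 2) (p 5) with ha
  set b := Ft (p 2) (p 5) with hb
  -- The gradients of the two equations at p have inner product 2 (l R² - z F_z), which this l makes
  -- zero. The second gradient then has squared length n.
  set l := a * p 2 / R ^ 2 with hl
  set ζ := p 2 ^ 2 / R ^ 2 with hζ
  set N := √n with hN
  have hN0 : 0 < N := Real.sqrt_pos.2 hn0
  have hNn : N ^ 2 = n := Real.sq_sqrt hn0.le
  have hR0 := hR.ne'
  have hlz : l * p 2 = a * ζ := by rw [hl, hζ]; ring
  have hlR : l * R ^ 2 = a * p 2 := by rw [hl]; field_simp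
  have hζR : ζ * R ^ 2 = p 2 ^ 2 := by rw [hζ]; field_simp
  have hxy : p 0 ^ 2 + p 1 ^ 2 = R ^ 2 - p 2 ^ 2 := by linarith
  have hC : l ^ 2 * (R ^ 2 - p 2 ^ 2) + (l * p 2 - a) ^ 2 = a ^ 2 * (1 - ζ) := by
    linear_combination l * hlR - a * hlz
  let u : EuclideanSpace ℝ (Fin 6) := !₂[p 0 / R, p 1 / R, p 2 / R, 0, 0, 0]
  let v : EuclideanSpace ℝ (Fin 6) :=
    !₂[l * p 0 / N, l * p 1 / N, (l * p 2 - a) / N, 2 * p 3 / N, 2 * p 4 / N, -b / N]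
  have huu : ⟪u, u⟫_ℝ = 1 := by
    simp only [inner_eq_sum_six, u]
    simp
    field_simp
    linarith
  have hvv : ⟪v, v⟫_ℝ = 1 := by
    simp only [inner_eq_sum_six, v]
    simp
    field_simp
    rw [hNn, hn]
    linear_combination hC + 4 * hp2 + l ^ 2 * hxy
  have huv : ⟪u, v⟫_ℝ = 0 := by
    simp only [inner_eq_sum_six, u, v]
    simp
    field_simp
    linear_combination l * hp1 + hlR
  clear_value l ζ
  obtain ⟨e, he0, he1⟩ := exists_orthonormalBasis_inr (m := 4) huu hvv huv
  have hAs : ∀ (c : Fin 2) (y w : EuclideanSpace ℝ (Fin 6)),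
      ⟪(![hessianOp 2 2 0 0 0, hessianOp l (l - Fzz) (-Fzt) 2 (-Ftt)] : Fin 2 → _) c y, w⟫_ℝ =
        ⟪y, (![hessianOp 2 2 0 0 0, hessianOp l (l - Fzz) (-Fzt) 2 (-Ftt)] : Fin 2 → _) c w⟫_ℝ := by
    rw [Fin.forall_fin_two]
    constructor <;> intro y w <;> rw [real_inner_comm _ y] <;> simp [inner_hessianOp] <;> ring
  obtain ⟨U, ψ, hψ, x, hx, hxp, hs⟩ := exists_parametrization_scalarCurvature (e := e)
    (ν := ![2 * R, N]) (fun q => mem_circleBundle_iff (l := l) q) hp (contDiff_bundleEquation hF)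
    (hasFDerivAt_bundleEquation hd) (hasFDerivAt_bundleGradient hFz hFt)
    hAs
    (by
      rw [Fin.forall_fin_two]
      simp [hR0, hN0.ne'])
    (by
      rw [Fin.forall_fin_two]
      constructor
      · ext i
        fin_cases i <;> simp [bundleGradient, he0, u] <;> field_simp
      · ext i
        fin_cases i <;> simp [bundleGradient, he1, v, ← ha, ← hb] <;> field_simp)
  refine ⟨U, ψ, hψ, x, hx, hxp, hs.trans ?_⟩
  simp only [sum_inner_apply_self_inl e (EuclideanSpace.basisFun (Fin 6) ℝ)]
  simp only [Fin.sum_univ_two, sum_sq_inner_apply_inl (hAs _) e (EuclideanSpace.basisFun (Fin 6) ℝ)]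
  simp only [Matrix.cons_val_zero, Matrix.cons_val_one, he0, he1, sum_inner_hessianOp,
    sum_inner_hessianOp_hessianOp]
  have a11 : ⟪hessianOp 2 2 0 0 0 u, u⟫_ℝ = 2 := by
    simp only [inner_hessianOp, u]
    simp
    field_simp
    linarith
  have a12 : ⟪hessianOp 2 2 0 0 0 u, v⟫_ℝ = 0 := by
    simp only [inner_hessianOp, u, v]
    simp
    field_simp
    linear_combination 2 * l * hp1 + 2 * hlR
  have a21 : ⟪hessianOp 2 2 0 0 0 v, u⟫_ℝ = 0 := by
    simp only [inner_hessianOp, u, v]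
    simp
    field_simp
    linear_combination 2 * l * hp1 + 2 * hlR
  have a22 : ⟪hessianOp 2 2 0 0 0 v, v⟫_ℝ = 2 * (a ^ 2 * (1 - ζ) / n) := by
    simp only [inner_hessianOp, v]
    simp
    field_simp
    rw [hNn]
    linear_combination n * hC + n * l ^ 2 * hxy
  have a1 : ⟪hessianOp 2 2 0 0 0 u, hessianOp 2 2 0 0 0 u⟫_ℝ = 4 := by
    simp only [inner_hessianOp_hessianOp, u]
    simp
    field_simp
    linarith
  have a2 : ⟪hessianOp 2 2 0 0 0 v, hessianOp 2 2 0 0 0 v⟫_ℝ = 4 * (a ^ 2 * (1 - ζ) / n) := by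
    simp only [inner_hessianOp_hessianOp, v]
    simp
    field_simp
    rw [hNn]
    linear_combination 4 * n * hC + 4 * n * l ^ 2 * hxy
  have b11 : ⟪hessianOp l (l - Fzz) (-Fzt) 2 (-Ftt) u, u⟫_ℝ = l - Fzz * ζ := by
    simp only [inner_hessianOp, u]
    simp
    field_simp
    linear_combination l * hp1 + Fzz * hζR
  have b12 : ⟪hessianOp l (l - Fzz) (-Fzt) 2 (-Ftt) u, v⟫_ℝ =
      p 2 / (R * N) * (Fzz * a * (1 - ζ) + Fzt * b) := by
    simp only [inner_hessianOp, u, v]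
    simp
    field_simp
    linear_combination l ^ 2 * hp1 + l * hlR - Fzz * p 2 * hlz
  have b21 : ⟪hessianOp l (l - Fzz) (-Fzt) 2 (-Ftt) v, u⟫_ℝ =
      p 2 / (R * N) * (Fzz * a * (1 - ζ) + Fzt * b) := by
    rw [← b12, real_inner_comm]
    exact (hAs 1 u v).symm
  have b22 : ⟪hessianOp l (l - Fzz) (-Fzt) 2 (-Ftt) v, v⟫_ℝ =
      (l * a ^ 2 * (1 - ζ) - Fzz * a ^ 2 * (1 - ζ) ^ 2 - 2 * Fzt * b * a * (1 - ζ)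
        + 8 * F (p 2) (p 5) - Ftt * b ^ 2) / n := by
    rw [← hNn]
    simp only [inner_hessianOp, v]
    simp
    field_simp
    rw [← hp2]
    linear_combination l * hC + l ^ 3 * hxy - (Fzz * (l * p 2 - a + -(a * (1 - ζ))) - 2 * Fzt * b) * hlz
  have b1 : ⟪hessianOp l (l - Fzz) (-Fzt) 2 (-Ftt) u, hessianOp l (l - Fzz) (-Fzt) 2 (-Ftt) u⟫_ℝ =
      l ^ 2 + (-2 * l * Fzz + Fzz ^ 2 + Fzt ^ 2) * ζ := by
    simp only [inner_hessianOp_hessianOp, u]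
    simp
    field_simp
    linear_combination l ^ 2 * hp1 - (-2 * l * Fzz + Fzz ^ 2 + Fzt ^ 2) * hζR
  have b2 : ⟪hessianOp l (l - Fzz) (-Fzt) 2 (-Ftt) v, hessianOp l (l - Fzz) (-Fzt) 2 (-Ftt) v⟫_ℝ =
      (l ^ 2 * a ^ 2 * (1 - ζ) + (Fzz ^ 2 - 2 * l * Fzz) * a ^ 2 * (1 - ζ) ^ 2
        - 2 * (l - Fzz) * a * (1 - ζ) * Fzt * b + Fzt ^ 2 * b ^ 2 + 16 * F (p 2) (p 5)
        + (Fzt * a * (1 - ζ) + Ftt * b) ^ 2) / n := by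
    rw [← hNn]
    have hq : l * p 2 - a = -(a * (1 - ζ)) := by linear_combination hlz
    rw [hq] at hC
    simp only [inner_hessianOp_hessianOp, v]
    simp
    rw [hq]
    field_simp
    rw [← hp2]
    linear_combination l ^ 2 * hC + l ^ 4 * hxy
  rw [a11, a12, a21, a22, a1, a2, b11, b12, b21, b22, b1, b2,
    ← curvatureNumerator_identity hn0.ne' hn rfl rfl rfl rfl rfl]
  have hP : (p 2 / (R * N) * (Fzz * a * (1 - ζ) + Fzt * b)) ^ 2 =
      ζ * (Fzz * a * (1 - ζ) + Fzt * b) ^ 2 / n := by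
    rw [← hNn, mul_pow, div_pow, mul_pow]
    field_simp
    rw [← hζR]
    ring
  rw [hP, hNn]
  congr 1
  field_simp
  ring

end CircleBundle

/-! ### The profile function -/

/-- The derivative of `expNegInvGlue`. -/
def glueDeriv (x : ℝ) : ℝ := x⁻¹ ^ 2 * expNegInvGlue x

/-- The second derivative of `expNegInvGlue`. -/
def glueDeriv₂ (x : ℝ) : ℝ := (x⁻¹ ^ 4 - 2 * x⁻¹ ^ 3) * expNegInvGlue x

theorem hasDerivAt_expNegInvGlue (x : ℝ) : HasDerivAt expNegInvGlue (glueDeriv x) x := by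
  have := expNegInvGlue.hasDerivAt_polynomial_eval_inv_mul 1 x
  convert! this using 1 <;> simp [glueDeriv]

theorem hasDerivAt_glueDeriv (x : ℝ) : HasDerivAt glueDeriv (glueDeriv₂ x) x := by
  have := expNegInvGlue.hasDerivAt_polynomial_eval_inv_mul (Polynomial.X ^ 2) x
  convert! this using 1
  · ext y
    simp [glueDeriv]
  · simp only [glueDeriv₂]
    congr 1
    simp
    ring

theorem glueDeriv_nonneg (x : ℝ) : 0 ≤ glueDeriv x :=
  mul_nonneg (by positivity) (expNegInvGlue.nonneg x)

theorem glueDeriv_pos {x : ℝ} (hx : 0 < x) : 0 < glueDeriv x :=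
  mul_pos (by positivity) (expNegInvGlue.pos_of_pos hx)

theorem glueDeriv_of_nonpos {x : ℝ} (hx : x ≤ 0) : glueDeriv x = 0 := by
  simp [glueDeriv, expNegInvGlue.zero_of_nonpos hx]

theorem glueDeriv₂_of_nonpos {x : ℝ} (hx : x ≤ 0) : glueDeriv₂ x = 0 := by
  simp [glueDeriv₂, expNegInvGlue.zero_of_nonpos hx]

theorem inv_pow_mul_expNegInvGlue_le {x : ℝ} (hx : 0 < x) (n : ℕ) :
    x⁻¹ ^ n * expNegInvGlue x ≤ n.factorial := by
  have h := Real.pow_div_factorial_le_exp x⁻¹ (by positivity) n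
  rw [div_le_iff₀ (by positivity)] at h
  rw [expNegInvGlue, if_neg hx.not_ge, Real.exp_neg, ← div_eq_mul_inv, div_le_iff₀ (Real.exp_pos _)]
  linarith

theorem glueDeriv_le (x : ℝ) : glueDeriv x ≤ 2 := by
  rcases le_or_gt x 0 with hx | hx
  · rw [glueDeriv_of_nonpos hx]
    norm_num
  · exact (inv_pow_mul_expNegInvGlue_le hx 2).trans (by norm_num)

/-- 36 = 4! + 2 · 3!, from the two monomials of `glueDeriv₂`. -/
theorem abs_glueDeriv₂_le (x : ℝ) : |glueDeriv₂ x| ≤ 36 := by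
  rcases le_or_gt x 0 with hx | hx
  · rw [glueDeriv₂_of_nonpos hx]
    norm_num
  · have h3 := inv_pow_mul_expNegInvGlue_le hx 3
    have h4 := inv_pow_mul_expNegInvGlue_le hx 4
    have h3' : 0 ≤ x⁻¹ ^ 3 * expNegInvGlue x := mul_nonneg (by positivity) (expNegInvGlue.nonneg x)
    have h4' : 0 ≤ x⁻¹ ^ 4 * expNegInvGlue x := mul_nonneg (by positivity) (expNegInvGlue.nonneg x)
    rw [glueDeriv₂, sub_mul, mul_assoc, abs_le]
    constructor <;> linarith

/-- For x > 0 the quotient of the two derivatives is x⁻² - 2 x⁻¹, at least 1 once x⁻¹ ≥ 4. The range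
x ≤ 1/4 is all that occurs where r ≥ 0, and the chain rule factor δ⁻¹ turns the inequality into p ≤
δ q. -/
theorem glueDeriv_le_glueDeriv₂ {x : ℝ} (hx : x ≤ 1 / 4) : glueDeriv x ≤ glueDeriv₂ x := by
  rcases le_or_gt x 0 with h | h
  · rw [glueDeriv_of_nonpos h, glueDeriv₂_of_nonpos h]
  · have h4 : 4 ≤ x⁻¹ := by
      rw [le_inv_comm₀ (by norm_num) h]
      linarith
    refine mul_le_mul_of_nonneg_right ?_ (expNegInvGlue.nonneg x)
    have : 0 ≤ x⁻¹ ^ 2 * (x⁻¹ ^ 2 - 2 * x⁻¹ - 1) := mul_nonneg (by positivity) (by nlinarith)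
    linarith

theorem expNegInvGlue_le_glueDeriv {x : ℝ} (h0 : 0 < x) (h1 : x ≤ 1) :
    expNegInvGlue x ≤ glueDeriv x :=
  le_mul_of_one_le_left (expNegInvGlue.nonneg x) (one_le_pow₀ ((one_le_inv₀ h0).2 h1))

theorem strictMonoOn_expNegInvGlue : StrictMonoOn expNegInvGlue (Set.Ici 0) := by
  refine strictMonoOn_of_deriv_pos (convex_Ici 0)
    (expNegInvGlue.contDiff (n := 0)).continuous.continuousOn fun x hx => ?_
  rw [interior_Ici] at hx
  rw [(hasDerivAt_expNegInvGlue x).deriv]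
  exact glueDeriv_pos hx

theorem lt_of_expNegInvGlue_lt {x y : ℝ} (h : expNegInvGlue x < expNegInvGlue y) : x < y :=
  lt_of_not_ge fun hyx => (expNegInvGlue.monotone hyx).not_gt h

/-- An affine function of the height `z` on the sphere of radius `R`, equal to `1` on the parallel
`z = s R` and to `-1` at the pole. -/
def capCoord (s R z : ℝ) : ℝ := (1 + s - 2 * (z / R)) / (1 - s)

/-- The function of height and time of which the squared radius of the circle is a function. -/
def depth (s R z t : ℝ) : ℝ :=
  expNegInvGlue 1 - expNegInvGlue (capCoord s R z) - expNegInvGlue (1 / 2 - t)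

/-- The squared radius of the circle factor as a function of height and time. -/
def radiusSq (s R δ η z t : ℝ) : ℝ :=
  η * (1 - (expNegInvGlue (1 / 4))⁻¹ * expNegInvGlue (depth s R z t / δ))

/-- Minus the derivative of `radiusSq` with respect to `depth`. -/
def radiusSlope (s R δ η z t : ℝ) : ℝ :=
  η * (expNegInvGlue (1 / 4))⁻¹ * δ⁻¹ * glueDeriv (depth s R z t / δ)

/-- Minus the second derivative of `radiusSq` with respect to `depth`. -/
def radiusSlope₂ (s R δ η z t : ℝ) : ℝ :=
  η * (expNegInvGlue (1 / 4))⁻¹ * δ⁻¹ ^ 2 * glueDeriv₂ (depth s R z t / δ)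

/-- The derivative of `depth` with respect to the height. -/
def depthDerivHeight (s R z : ℝ) : ℝ := 2 / (R * (1 - s)) * glueDeriv (capCoord s R z)

/-! ### First and second derivatives of the profile. -/

section Derivatives

variable (s R δ η : ℝ) (q : ℝ × ℝ)

local notation "dz" => ContinuousLinearMap.fst ℝ ℝ ℝ
local notation "dt" => ContinuousLinearMap.snd ℝ ℝ ℝ

theorem hasFDerivAt_capCoord :
    HasFDerivAt (fun q : ℝ × ℝ => capCoord s R q.1) (-(2 / (R * (1 - s))) • dz) q := by
  have h := (((hasFDerivAt_fst (𝕜 := ℝ) (p := q)).mul_const (2 / (R * (1 - s)))).const_sub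
    ((1 + s) / (1 - s)))
  have h2 : (fun q : ℝ × ℝ => capCoord s R q.1) =
      fun q => (1 + s) / (1 - s) - q.1 * (2 / (R * (1 - s))) := by
    ext y
    rw [capCoord, sub_div, ← mul_div_assoc, div_div, ← mul_div_assoc, mul_comm y.1]
  rw [h2]
  refine h.congr_fderiv ?_
  ext <;> simp

theorem hasFDerivAt_time : HasFDerivAt (fun q : ℝ × ℝ => 1 / 2 - q.2) (-dt) q :=
  (hasFDerivAt_snd (𝕜 := ℝ) (p := q)).const_sub (1 / 2)

theorem hasFDerivAt_depth :
    HasFDerivAt (fun q : ℝ × ℝ => depth s R q.1 q.2)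
      (depthDerivHeight s R q.1 • dz + glueDeriv (1 / 2 - q.2) • dt) q := by
  have h1 := (hasDerivAt_expNegInvGlue _).comp_hasFDerivAt q (hasFDerivAt_capCoord s R q)
  have h2 := (hasDerivAt_expNegInvGlue _).comp_hasFDerivAt q (hasFDerivAt_time q)
  refine ((h1.const_sub (expNegInvGlue 1)).sub h2).congr_fderiv ?_
  ext
  · simp [depthDerivHeight]
    ring
  · simp

theorem hasFDerivAt_depthDerivHeight :
    HasFDerivAt (fun q : ℝ × ℝ => depthDerivHeight s R q.1)
      (-((2 / (R * (1 - s))) ^ 2 * glueDeriv₂ (capCoord s R q.1)) • dz) q := by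
  have h1 := (hasDerivAt_glueDeriv _).comp_hasFDerivAt q (hasFDerivAt_capCoord s R q)
  refine (h1.const_mul (2 / (R * (1 - s)))).congr_fderiv ?_
  ext
  · simp
    ring
  · simp

theorem hasFDerivAt_depth_div :
    HasFDerivAt (fun q : ℝ × ℝ => depth s R q.1 q.2 / δ)
      (δ⁻¹ • (depthDerivHeight s R q.1 • dz + glueDeriv (1 / 2 - q.2) • dt)) q := by
  simp_rw [div_eq_mul_inv]
  exact (hasFDerivAt_depth s R q).mul_const δ⁻¹

theorem hasFDerivAt_radiusSq :
    HasFDerivAt (fun q : ℝ × ℝ => radiusSq s R δ η q.1 q.2)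
      (-(radiusSlope s R δ η q.1 q.2 * depthDerivHeight s R q.1) • dz
        + -(radiusSlope s R δ η q.1 q.2 * glueDeriv (1 / 2 - q.2)) • dt) q := by
  have h1 := (hasDerivAt_expNegInvGlue _).comp_hasFDerivAt q (hasFDerivAt_depth_div s R δ q)
  refine (((h1.const_mul (expNegInvGlue (1 / 4))⁻¹).const_sub 1).const_mul η).congr_fderiv ?_
  ext <;> simp [radiusSlope] <;> ring

theorem hasFDerivAt_radiusSlope :
    HasFDerivAt (fun q : ℝ × ℝ => radiusSlope s R δ η q.1 q.2)
      ((radiusSlope₂ s R δ η q.1 q.2 * depthDerivHeight s R q.1) • dz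
        + (radiusSlope₂ s R δ η q.1 q.2 * glueDeriv (1 / 2 - q.2)) • dt) q := by
  have h1 := (hasDerivAt_glueDeriv _).comp_hasFDerivAt q (hasFDerivAt_depth_div s R δ q)
  refine (h1.const_mul (η * (expNegInvGlue (1 / 4))⁻¹ * δ⁻¹)).congr_fderiv ?_
  ext <;> simp [radiusSlope₂] <;> ring

theorem hasFDerivAt_radiusSq_height :
    HasFDerivAt (fun q : ℝ × ℝ => -(radiusSlope s R δ η q.1 q.2 * depthDerivHeight s R q.1))
      (-(radiusSlope₂ s R δ η q.1 q.2 * depthDerivHeight s R q.1 ^ 2 + radiusSlope s R δ η q.1 q.2 *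
          -((2 / (R * (1 - s))) ^ 2 * glueDeriv₂ (capCoord s R q.1))) • dz
        + -(radiusSlope₂ s R δ η q.1 q.2 * depthDerivHeight s R q.1 * glueDeriv (1 / 2 - q.2)) • dt)
      q := by
  refine ((hasFDerivAt_radiusSlope s R δ η q).mul
    (hasFDerivAt_depthDerivHeight s R q)).neg.congr_fderiv ?_
  ext <;> simp <;> ring

theorem hasFDerivAt_radiusSq_time :
    HasFDerivAt (fun q : ℝ × ℝ => -(radiusSlope s R δ η q.1 q.2 * glueDeriv (1 / 2 - q.2)))
      (-(radiusSlope₂ s R δ η q.1 q.2 * depthDerivHeight s R q.1 * glueDeriv (1 / 2 - q.2)) • dz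
        + -(radiusSlope₂ s R δ η q.1 q.2 * glueDeriv (1 / 2 - q.2) ^ 2 + radiusSlope s R δ η q.1 q.2 *
          -glueDeriv₂ (1 / 2 - q.2)) • dt)
      q := by
  refine ((hasFDerivAt_radiusSlope s R δ η q).mul
    ((hasDerivAt_glueDeriv _).comp_hasFDerivAt q (hasFDerivAt_time q))).neg.congr_fderiv ?_
  ext <;> simp <;> ring

theorem contDiff_radiusSq : ContDiff ℝ ∞ (fun q : ℝ × ℝ => radiusSq s R δ η q.1 q.2) := by
  have hE : ContDiff ℝ ∞ expNegInvGlue := expNegInvGlue.contDiff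
  have h1 : ContDiff ℝ ∞ fun q : ℝ × ℝ => capCoord s R q.1 := by
    unfold capCoord
    fun_prop
  have h2 : ContDiff ℝ ∞ fun q : ℝ × ℝ => depth s R q.1 q.2 / δ :=
    ((contDiff_const.sub (hE.comp h1)).sub (hE.comp (contDiff_const.sub contDiff_snd))).div_const δ
  exact contDiff_const.mul (contDiff_const.sub (contDiff_const.mul (hE.comp h2)))

end Derivatives

/-! ### Positivity of the curvature numerator. -/

/-- `curvatureNumerator` for a function with derivatives `-p * d`, where `d` and `h` are the
derivatives of a depth function. -/
theorem curvatureNumerator_of_depth (R ζ l r p q a b h₁ azz btt : ℝ) (hl : l = p * h₁) :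
    curvatureNumerator R ζ l r (-(p * a)) (-(p * b)) (-(q * a ^ 2 + p * azz)) (-(q * a * b))
      (-(q * b ^ 2 + p * btt)) =
    (4 * r + p ^ 2 * (a ^ 2 * (1 - ζ) + b ^ 2)) * (4 * r + p ^ 2 * b ^ 2) / R ^ 2
      + 4 * p ^ 2 * (a ^ 2 * (1 - ζ) + b ^ 2)
      + 8 * r * (p * (h₁ + (h₁ + azz * (1 - ζ)) + btt) + q * (a ^ 2 * (1 - ζ) + b ^ 2))
      + 4 * p ^ 3 * (h₁ * (a ^ 2 * (1 - ζ) + b ^ 2) + (h₁ + azz * (1 - ζ)) * b ^ 2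
          + btt * (a ^ 2 * (1 - ζ)))
      + 4 * r * (p ^ 2 * (h₁ * (h₁ + azz * (1 - ζ)) + h₁ * btt + (h₁ + azz * (1 - ζ)) * btt)
          + p * q * (h₁ * (a ^ 2 * (1 - ζ) + b ^ 2) + (h₁ + azz * (1 - ζ)) * b ^ 2
          + btt * (a ^ 2 * (1 - ζ))))
      + p ^ 4 * (h₁ * ((h₁ + azz * (1 - ζ)) * b ^ 2 + btt * (a ^ 2 * (1 - ζ)))) := by
  subst hl
  unfold curvatureNumerator
  ring

/-- The estimate behind positivity of the scalar curvature. -/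
theorem curvature_estimate {R r p q δ g c C B t K σ L : ℝ} (hR : 0 < R) (hr : 0 ≤ r) (hp : 0 ≤ p)
    (hpq : p ≤ δ * q) (hq : 0 ≤ q) (hB : 0 ≤ B) (hc : 0 < c)
    (hcg : c ≤ g) (hC : 0 ≤ C) (ht : |t| ≤ C) (hK : |K| ≤ C) (hσ : |σ| ≤ C) (hL : |L| ≤ C)
    (hδ : δ * C ≤ c / 2) (hpC : p * C ≤ c / 4) (hrC : r * C ≤ c / 4) (hp1 : p ≤ 1)
    (hrp : 0 < r ∨ 0 < p) :
    0 < (4 * r + p ^ 2 * g) * (4 * r + p ^ 2 * B) / R ^ 2 + 4 * p ^ 2 * g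
      + 8 * r * (p * t + q * g) + 4 * p ^ 3 * K + 4 * r * (p ^ 2 * σ + p * q * K) + p ^ 4 * L := by
  have ht' := (abs_le.1 ht).1
  have hK' := (abs_le.1 hK).1
  have hσ' := (abs_le.1 hσ).1
  have hL' := (abs_le.1 hL).1
  have hrq : 0 ≤ r * q := mul_nonneg hr hq
  have hrp0 : 0 ≤ r * p := mul_nonneg hr hp
  have hp2 : 0 ≤ p ^ 2 := sq_nonneg p
  have hg0 : 0 < g := hc.trans_le hcg
  -- The Laplacian term has no small factor of its own; p ≤ δ q converts it to r q, at the cost of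
  -- half of r q c.
  have e1 : r * p * t ≥ -(r * q * (c / 2)) := by
    have h1 : r * p * t ≥ r * p * (-C) := mul_le_mul_of_nonneg_left ht' hrp0
    have h2 : r * p * C ≤ r * (δ * q) * C :=
      mul_le_mul_of_nonneg_right (mul_le_mul_of_nonneg_left hpq hr) hC
    have h3 : r * q * (δ * C) ≤ r * q * (c / 2) := mul_le_mul_of_nonneg_left hδ hrq
    linarith
  have e2 : r * q * g ≥ r * q * c := mul_le_mul_of_nonneg_left hcg hrq
  have e3 : r * q * p * K ≥ -(r * q * (c / 4)) := by
    have h1 : r * q * p * K ≥ r * q * p * (-C) := mul_le_mul_of_nonneg_left hK' (mul_nonneg hrq hp)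
    have h2 : r * q * (p * C) ≤ r * q * (c / 4) := mul_le_mul_of_nonneg_left hpC hrq
    linarith
  have e4 : p ^ 2 * g ≥ p ^ 2 * c := mul_le_mul_of_nonneg_left hcg hp2
  have e5 : p ^ 2 * p * K ≥ -(p ^ 2 * (c / 4)) := by
    have h1 : p ^ 2 * p * K ≥ p ^ 2 * p * (-C) := mul_le_mul_of_nonneg_left hK' (mul_nonneg hp2 hp)
    have h2 : p ^ 2 * (p * C) ≤ p ^ 2 * (c / 4) := mul_le_mul_of_nonneg_left hpC hp2
    linarith
  have e6 : p ^ 2 * r * σ ≥ -(p ^ 2 * (c / 4)) := by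
    have h1 : p ^ 2 * r * σ ≥ p ^ 2 * r * (-C) := mul_le_mul_of_nonneg_left hσ' (mul_nonneg hp2 hr)
    have h2 : p ^ 2 * (r * C) ≤ p ^ 2 * (c / 4) := mul_le_mul_of_nonneg_left hrC hp2
    linarith
  have e7 : p ^ 2 * p * p * L ≥ -(p ^ 2 * (c / 4)) := by
    have h1 : p ^ 2 * p * p * L ≥ p ^ 2 * p * p * (-C) :=
      mul_le_mul_of_nonneg_left hL' (mul_nonneg (mul_nonneg hp2 hp) hp)
    have h2 : p ^ 2 * p * (p * C) ≤ p ^ 2 * p * (c / 4) :=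
      mul_le_mul_of_nonneg_left hpC (mul_nonneg hp2 hp)
    have h3 : p ^ 2 * p * (c / 4) ≤ p ^ 2 * 1 * (c / 4) :=
      mul_le_mul_of_nonneg_right (mul_le_mul_of_nonneg_left hp1 hp2) (by linarith)
    linarith
  have e8 : r * q * c ≥ 0 := mul_nonneg hrq hc.le
  -- One of the four copies of p² c is kept for strict positivity; the error terms use 9/4 of the
  -- other three. The sphere term takes over where p = 0.
  have hmain : (4 * r + p ^ 2 * g) * (4 * r + p ^ 2 * B) / R ^ 2 + p ^ 2 * c > 0 := by
    rcases hrp with h | h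
    · have : 0 < (4 * r + p ^ 2 * g) * (4 * r + p ^ 2 * B) / R ^ 2 := by positivity
      have : 0 ≤ p ^ 2 * c := by positivity
      linarith
    · have : 0 ≤ (4 * r + p ^ 2 * g) * (4 * r + p ^ 2 * B) / R ^ 2 := by positivity
      have : 0 < p ^ 2 * c := by positivity
      linarith
  have e9 : 0 ≤ p ^ 2 * c := by positivity
  linarith

theorem abs_mul_le_of_abs_le {a b A B : ℝ} (ha : |a| ≤ A) (hb : |b| ≤ B) : |a * b| ≤ A * B := by
  rw [abs_mul]
  exact mul_le_mul ha hb (abs_nonneg _) ((abs_nonneg _).trans ha)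

/-- The depth is a function of z plus a function of t, so its Hessian is diagonal along parallel,
meridian and time, with entries h₁, h₂, h₃. W and B are its squared derivatives along meridian and
time. The four expressions are the coefficients in `curvatureNumerator_of_depth`. -/
theorem curvature_coefficient_bounds {M h₁ h₂ h₃ W B : ℝ} (hM : 1 ≤ M) (h1 : |h₁| ≤ M)
    (h2 : |h₂| ≤ M) (h3 : |h₃| ≤ M) (hW : |W| ≤ M) (hB : |B| ≤ M) :
    |h₁ + h₂ + h₃| ≤ 4 * M ^ 3 ∧ |h₁ * (W + B) + h₂ * B + h₃ * W| ≤ 4 * M ^ 3 ∧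
      |h₁ * h₂ + h₁ * h₃ + h₂ * h₃| ≤ 4 * M ^ 3 ∧ |h₁ * (h₂ * B + h₃ * W)| ≤ 4 * M ^ 3 := by
  have hM2 : M ≤ M ^ 2 := by nlinarith
  have hM3 : M ^ 2 ≤ M ^ 3 := by nlinarith [sq_nonneg M]
  have hWB : |W + B| ≤ 2 * M := (abs_add_le _ _).trans (by linarith)
  have e1 := abs_mul_le_of_abs_le h1 hWB
  have e2 := abs_mul_le_of_abs_le h2 hB
  have e3 := abs_mul_le_of_abs_le h3 hW
  have e4 := abs_mul_le_of_abs_le h1 h2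
  have e5 := abs_mul_le_of_abs_le h1 h3
  have e6 := abs_mul_le_of_abs_le h2 h3
  have e7 : |h₂ * B + h₃ * W| ≤ M * M + M * M := (abs_add_le _ _).trans (add_le_add e2 e3)
  have e8 := abs_mul_le_of_abs_le h1 e7
  refine ⟨?_, ?_, ?_, ?_⟩
  · refine (abs_add_three _ _ _).trans ?_
    linarith
  · refine (abs_add_three _ _ _).trans ?_
    linarith
  · refine (abs_add_three _ _ _).trans ?_
    linarith
  · refine e8.trans ?_
    nlinarith

/-! ### Bounds on the depth and the choice of δ and η. -/

section Profile

variable {s R : ℝ}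

theorem exists_depth_bound (hs1 : s < 1) (hR : 0 < R) :
    ∃ M, 1 ≤ M ∧ ∀ z t, z ^ 2 ≤ R ^ 2 →
      |-(depthDerivHeight s R z * z / R ^ 2)| ≤ M ∧
      |-(depthDerivHeight s R z * z / R ^ 2)
        + -((2 / (R * (1 - s))) ^ 2 * glueDeriv₂ (capCoord s R z)) * (1 - z ^ 2 / R ^ 2)| ≤ M ∧
      |-glueDeriv₂ (1 / 2 - t)| ≤ M ∧
      |depthDerivHeight s R z ^ 2 * (1 - z ^ 2 / R ^ 2)| ≤ M ∧ |glueDeriv (1 / 2 - t) ^ 2| ≤ M := by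
  set m := 2 / (R * (1 - s)) with hm
  have hm0 : 0 < m := by
    have : 0 < 1 - s := by linarith
    positivity
  have hgl : ∀ x, |glueDeriv x| ≤ 2 := fun x => by
    rw [abs_of_nonneg (glueDeriv_nonneg x)]
    exact glueDeriv_le x
  refine ⟨36 + m * 2 * (1 / R) + m ^ 2 * 36 + (m * 2) ^ 2, ?_, fun z t hz => ?_⟩
  · have : 0 < m * 2 * (1 / R) + m ^ 2 * 36 + (m * 2) ^ 2 := by positivity
    linarith
  have p1 : 0 < m * 2 * (1 / R) := by positivity
  have p2 : 0 < m ^ 2 * 36 := by positivity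
  have p3 : 0 < (m * 2) ^ 2 := by positivity
  have hζ : |1 - z ^ 2 / R ^ 2| ≤ 1 := by
    have h1 : z ^ 2 / R ^ 2 ≤ 1 := (div_le_one (by positivity)).2 hz
    have h2 : 0 ≤ z ^ 2 / R ^ 2 := by positivity
    rw [abs_le]
    constructor <;> linarith
  have hd : |depthDerivHeight s R z| ≤ m * 2 :=
    abs_mul_le_of_abs_le (abs_of_pos hm0).le (hgl _)
  have hzR : |z / R ^ 2| ≤ 1 / R := by
    rw [abs_div, abs_of_pos (by positivity : 0 < R ^ 2), div_le_div_iff₀ (by positivity) hR]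
    have := mul_le_mul_of_nonneg_right (abs_le_of_sq_le_sq hz hR.le) hR.le
    linarith
  have h1 : |-(depthDerivHeight s R z * z / R ^ 2)| ≤ m * 2 * (1 / R) := by
    rw [abs_neg, mul_div_assoc]
    exact abs_mul_le_of_abs_le hd hzR
  have h2 : |-(m ^ 2 * glueDeriv₂ (capCoord s R z)) * (1 - z ^ 2 / R ^ 2)| ≤ m ^ 2 * 36 * 1 := by
    refine abs_mul_le_of_abs_le ?_ hζ
    rw [abs_neg]
    exact abs_mul_le_of_abs_le (abs_of_pos (by positivity)).le (abs_glueDeriv₂_le _)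
  have h3 : |depthDerivHeight s R z ^ 2 * (1 - z ^ 2 / R ^ 2)| ≤ (m * 2) ^ 2 * 1 := by
    refine abs_mul_le_of_abs_le ?_ hζ
    rw [abs_pow]
    exact pow_le_pow_left₀ (abs_nonneg _) hd 2
  have h4 : |glueDeriv (1 / 2 - t) ^ 2| ≤ 4 := by
    rw [abs_pow]
    have := pow_le_pow_left₀ (abs_nonneg _) (hgl (1 / 2 - t)) 2
    linarith
  have h5 := abs_glueDeriv₂_le (1 / 2 - t)
  refine ⟨by linarith, (abs_add_le _ _).trans (by linarith), by rw [abs_neg]; linarith,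
    by linarith, by linarith⟩

/-- When the depth is at most E(1)/2, one of E(α), E(1/2 - t) is at least E(1)/4; positive depth
puts both arguments below 1, where E' ≥ E. If it is the height term, α > 0 gives z/R < (1 + s)/2,
away from the pole, where the gradient of z on the sphere degenerates. -/
theorem exists_depth_gradient_bound (hs0 : 0 < s) (hs1 : s < 1) (hR : 0 < R) :
    ∃ c, 0 < c ∧ ∀ z t, z ^ 2 ≤ R ^ 2 → 0 < depth s R z t →
      depth s R z t ≤ expNegInvGlue 1 / 2 →
      c ≤ depthDerivHeight s R z ^ 2 * (1 - z ^ 2 / R ^ 2) + glueDeriv (1 / 2 - t) ^ 2 := by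
  set k := expNegInvGlue 1 / 4 with hk
  have hk0 : 0 < k := by
    have := expNegInvGlue.pos_of_pos one_pos
    positivity
  have h1s : 0 < 1 - s := by linarith
  set m := 2 / (R * (1 - s)) with hm
  have hm0 : 0 < m := by positivity
  have hs1' : 0 < 1 - ((1 + s) / 2) ^ 2 := by nlinarith
  refine ⟨min (k ^ 2) ((m * k) ^ 2 * (1 - ((1 + s) / 2) ^ 2)), by positivity,
    fun z t hz h0 h1 => ?_⟩
  have hζ : z ^ 2 / R ^ 2 ≤ 1 := (div_le_one (by positivity)).2 hz
  have step : ∀ x, k ≤ expNegInvGlue x → x < 1 → 0 < x ∧ k ≤ glueDeriv x := fun x hx hx1 => by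
    have hx0 : 0 < x := by
      by_contra h
      rw [expNegInvGlue.zero_of_nonpos (not_lt.1 h)] at hx
      linarith
    exact ⟨hx0, hx.trans (expNegInvGlue_le_glueDeriv hx0 hx1.le)⟩
  have hα1 : capCoord s R z < 1 := lt_of_expNegInvGlue_lt (by
    have := expNegInvGlue.nonneg (1 / 2 - t)
    rw [depth] at h0
    linarith)
  have hβ1 : 1 / 2 - t < 1 := lt_of_expNegInvGlue_lt (by
    have := expNegInvGlue.nonneg (capCoord s R z)
    rw [depth] at h0
    linarith)
  rcases le_or_gt k (expNegInvGlue (1 / 2 - t)) with hβ | hβ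
  · obtain ⟨-, h3⟩ := step _ hβ hβ1
    refine (min_le_left _ _).trans ?_
    have h4 := pow_le_pow_left₀ hk0.le h3 2
    have h5 : 0 ≤ depthDerivHeight s R z ^ 2 * (1 - z ^ 2 / R ^ 2) :=
      mul_nonneg (sq_nonneg _) (by linarith)
    linarith
  · obtain ⟨h2, h3⟩ := step (capCoord s R z) (by rw [depth] at h1; linarith) hα1
    refine (min_le_right _ _).trans ?_
    have hz1 : z / R < (1 + s) / 2 := by
      rw [capCoord, div_pos_iff_of_pos_right h1s] at h2
      linarith
    have hz0 : 0 < z / R := by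
      rw [capCoord, div_lt_one h1s] at hα1
      linarith
    have hζ' : 1 - ((1 + s) / 2) ^ 2 ≤ 1 - z ^ 2 / R ^ 2 := by
      have := pow_le_pow_left₀ hz0.le hz1.le 2
      rw [div_pow z] at this
      linarith
    have h4 : (m * k) ^ 2 ≤ depthDerivHeight s R z ^ 2 :=
      pow_le_pow_left₀ (by positivity) (mul_le_mul_of_nonneg_left h3 hm0.le) 2
    have h5 := mul_le_mul h4 hζ' hs1'.le (sq_nonneg _)
    have h6 := sq_nonneg (glueDeriv (1 / 2 - t))
    linarith

theorem radiusSq_of_depth_nonpos {δ η z t : ℝ} (hδ : 0 < δ) (h : depth s R z t ≤ 0) :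
    radiusSq s R δ η z t = η := by
  rw [radiusSq, expNegInvGlue.zero_of_nonpos (div_nonpos_of_nonpos_of_nonneg h hδ.le)]
  ring

theorem radiusSq_le {δ η z t : ℝ} (hη : 0 ≤ η) : radiusSq s R δ η z t ≤ η := by
  have h := expNegInvGlue.nonneg (depth s R z t / δ)
  have h4 := expNegInvGlue.nonneg (1 / 4)
  exact mul_le_of_le_one_right hη (sub_le_self _ (mul_nonneg (inv_nonneg.2 h4) h))

theorem radiusSq_nonneg_iff {δ η z t : ℝ} (hη : 0 < η) :
    0 ≤ radiusSq s R δ η z t ↔ depth s R z t / δ ≤ 1 / 4 := by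
  have h4 := expNegInvGlue.pos_of_pos (by norm_num : (0 : ℝ) < 1 / 4)
  rw [radiusSq, mul_nonneg_iff_of_pos_left hη, sub_nonneg, inv_mul_le_one₀ h4]
  exact ⟨fun h => le_of_not_gt fun hlt => h.not_gt (strictMonoOn_expNegInvGlue
    (by norm_num) ((by norm_num : (0 : ℝ) ≤ 1 / 4).trans hlt.le) hlt),
    fun h => expNegInvGlue.monotone h⟩

theorem exists_isSubmanifoldWithPSC (hs0 : 0 < s) (hs1 : s < 1) (hR : 0 < R) :
    ∃ δ η, 0 < δ ∧ δ ≤ 2 * expNegInvGlue 1 ∧ 0 < η ∧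
      IsSubmanifoldWithPSC 4 (circleBundle R (radiusSq s R δ η)) := by
  obtain ⟨M, hM1, hM⟩ := exists_depth_bound hs1 hR
  obtain ⟨c, hc, hcb⟩ := exists_depth_gradient_bound hs0 hs1 hR
  have hE1 := expNegInvGlue.pos_of_pos one_pos
  have hE4 := expNegInvGlue.pos_of_pos (by norm_num : (0 : ℝ) < 1 / 4)
  set C := 4 * M ^ 3 with hCdef
  have hC : 0 < C := by positivity
  -- The first bound puts the depth on X, at most δ/4, in the range of the gradient estimate; the
  -- second absorbs the Laplacian term.
  set δ := min (2 * expNegInvGlue 1) (c / (2 * C)) with hδdef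
  have hδ : 0 < δ := by positivity
  have hδC : δ * C ≤ c / 2 := by
    have : δ ≤ c / (2 * C) := min_le_right _ _
    rw [le_div_iff₀ (by positivity)] at this
    linarith
  set P := min 1 (c / (4 * C)) with hPdef
  have hP : 0 < P := by positivity
  have hP1 : P ≤ 1 := min_le_left _ _
  have hPC : P * C ≤ c / 4 := by
    have : P ≤ c / (4 * C) := min_le_right _ _
    rw [le_div_iff₀ (by positivity)] at this
    linarith
  -- By E' ≤ 2 the slope p is at most η B, so the choice of η below makes both p and r at most P.
  set B := (expNegInvGlue (1 / 4))⁻¹ * δ⁻¹ * 2 with hBdef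
  have hB : 0 < B := by positivity
  set η := min P (P / B) with hηdef
  have hη : 0 < η := by positivity
  have hηP : η ≤ P := min_le_left _ _
  have hηB : η * B ≤ P := by
    have : η ≤ P / B := min_le_right _ _
    rwa [le_div_iff₀ hB] at this
  refine ⟨δ, η, hδ, min_le_left _ _, hη, fun p hp => ?_⟩
  obtain ⟨hp1, hp2⟩ := id hp
  have hz : p 2 ^ 2 ≤ R ^ 2 := by nlinarith [sq_nonneg (p 0), sq_nonneg (p 1)]
  have hr0 : 0 ≤ radiusSq s R δ η (p 2) (p 5) := by
    rw [← hp2]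
    positivity
  have hx := (radiusSq_nonneg_iff hη).1 hr0
  have hslope0 : 0 ≤ radiusSlope s R δ η (p 2) (p 5) :=
    mul_nonneg (by positivity) (glueDeriv_nonneg _)
  have hslopeP : radiusSlope s R δ η (p 2) (p 5) ≤ P := by
    refine le_trans ?_ hηB
    have := mul_le_mul_of_nonneg_left (glueDeriv_le (depth s R (p 2) (p 5) / δ))
      (by positivity : 0 ≤ η * (expNegInvGlue (1 / 4))⁻¹ * δ⁻¹)
    rw [radiusSlope, hBdef]
    linarith
  have hslopeδ : radiusSlope s R δ η (p 2) (p 5) ≤ δ * radiusSlope₂ s R δ η (p 2) (p 5) := by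
    have h1 : δ * radiusSlope₂ s R δ η (p 2) (p 5) = η * (expNegInvGlue (1 / 4))⁻¹ * δ⁻¹ *
        glueDeriv₂ (depth s R (p 2) (p 5) / δ) := by
      rw [radiusSlope₂]
      field_simp
    rw [h1]
    exact mul_le_mul_of_nonneg_left (glueDeriv_le_glueDeriv₂ hx) (by positivity)
  have hslope₂ : 0 ≤ radiusSlope₂ s R δ η (p 2) (p 5) :=
    nonneg_of_mul_nonneg_right (hslope0.trans hslopeδ) hδ
  have hrη : radiusSq s R δ η (p 2) (p 5) ≤ η := radiusSq_le hη.le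
  have hζ : 0 ≤ 1 - p 2 ^ 2 / R ^ 2 := sub_nonneg.2 ((div_le_one (by positivity)).2 hz)
  have key : 0 < 4 * radiusSq s R δ η (p 2) (p 5) + radiusSlope s R δ η (p 2) (p 5) ^ 2 *
        (depthDerivHeight s R (p 2) ^ 2 * (1 - p 2 ^ 2 / R ^ 2) + glueDeriv (1 / 2 - p 5) ^ 2) ∧
      0 < curvatureNumerator R (p 2 ^ 2 / R ^ 2)
        (-(radiusSlope s R δ η (p 2) (p 5) * depthDerivHeight s R (p 2)) * p 2 / R ^ 2)
        (radiusSq s R δ η (p 2) (p 5))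
        (-(radiusSlope s R δ η (p 2) (p 5) * depthDerivHeight s R (p 2)))
        (-(radiusSlope s R δ η (p 2) (p 5) * glueDeriv (1 / 2 - p 5)))
        (-(radiusSlope₂ s R δ η (p 2) (p 5) * depthDerivHeight s R (p 2) ^ 2
          + radiusSlope s R δ η (p 2) (p 5) *
            -((2 / (R * (1 - s))) ^ 2 * glueDeriv₂ (capCoord s R (p 2)))))
        (-(radiusSlope₂ s R δ η (p 2) (p 5) * depthDerivHeight s R (p 2)
          * glueDeriv (1 / 2 - p 5)))
        (-(radiusSlope₂ s R δ η (p 2) (p 5) * glueDeriv (1 / 2 - p 5) ^ 2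
          + radiusSlope s R δ η (p 2) (p 5) * -glueDeriv₂ (1 / 2 - p 5))) := by
    rw [curvatureNumerator_of_depth R _ _ _ _ _ _ _ (-(depthDerivHeight s R (p 2) * p 2 / R ^ 2))
      _ _ (by ring)]
    -- For depth ≤ 0 one has r = η and p = q = 0, and only the sphere term 16 η²/R² is left.
    rcases le_or_gt (depth s R (p 2) (p 5)) 0 with h0 | h0
    · have e0 : depth s R (p 2) (p 5) / δ ≤ 0 := div_nonpos_of_nonpos_of_nonneg h0 hδ.le
      rw [radiusSq_of_depth_nonpos hδ h0, radiusSlope, radiusSlope₂, glueDeriv_of_nonpos e0,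
        glueDeriv₂_of_nonpos e0]
      constructor <;> simp <;> positivity
    · have hD : depth s R (p 2) (p 5) ≤ expNegInvGlue 1 / 2 := by
        rw [div_le_iff₀ hδ] at hx
        have : δ ≤ 2 * expNegInvGlue 1 := min_le_left _ _
        linarith
      have hcg := hcb _ _ hz h0 hD
      obtain ⟨b1, b2, b3, b4, b5⟩ := hM (p 2) (p 5) hz
      obtain ⟨c1, c2, c3, c4⟩ := curvature_coefficient_bounds hM1 b1 b2 b3 b4 b5
      have hslope : 0 < radiusSlope s R δ η (p 2) (p 5) :=
        mul_pos (by positivity) (glueDeriv_pos (by positivity))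
      constructor
      · have : 0 < radiusSlope s R δ η (p 2) (p 5) ^ 2 *
          (depthDerivHeight s R (p 2) ^ 2 * (1 - p 2 ^ 2 / R ^ 2) + glueDeriv (1 / 2 - p 5) ^ 2) :=
          mul_pos (by positivity) (hc.trans_le hcg)
        linarith
      · exact curvature_estimate hR hr0 hslope0 hslopeδ hslope₂ (sq_nonneg _) hc hcg hC.le
          c1 c2 c3 c4 hδC ((mul_le_mul_of_nonneg_right hslopeP hC.le).trans hPC)
          ((mul_le_mul_of_nonneg_right (hrη.trans hηP) hC.le).trans hPC) (hslopeP.trans hP1)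
          (Or.inr hslope)
  obtain ⟨U, ψ, hψ, x, hxU, hxp, hscal⟩ := exists_parametrization_circleBundle hR
    (contDiff_radiusSq s R δ η)
    (Fz := fun z t => -(radiusSlope s R δ η z t * depthDerivHeight s R z))
    (Ft := fun z t => -(radiusSlope s R δ η z t * glueDeriv (1 / 2 - t)))
    (hasFDerivAt_radiusSq s R δ η) hp (hasFDerivAt_radiusSq_height s R δ η (p 2, p 5))
    (hasFDerivAt_radiusSq_time s R δ η (p 2, p 5)) rfl (by linarith [key.1])
  refine ⟨U, ψ, hψ, x, hxU, hxp, ?_⟩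
  rw [hscal]
  have hn := key.1
  refine div_pos (mul_pos two_pos key.2) (sq_pos_of_pos ?_)
  linarith

end Profile

/-! ### Boundary conditions and cylindrical ends. -/

section Boundary

variable {s R δ η z z' t t' : ℝ}

theorem capCoord_antitone (hs : s < 1) (hR : 0 < R) : Antitone (capCoord s R) := fun x y h => by
  have := div_le_div_of_nonneg_right h hR.le
  refine div_le_div_of_nonneg_right ?_ (by linarith)
  linarith

theorem depth_mono (hs : s < 1) (hR : 0 < R) (hz : z ≤ z') (ht : t ≤ t') :
    depth s R z t ≤ depth s R z' t' := by
  have h1 := expNegInvGlue.monotone (capCoord_antitone hs hR hz)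
  have h2 : expNegInvGlue (1 / 2 - t') ≤ expNegInvGlue (1 / 2 - t) :=
    expNegInvGlue.monotone (by linarith)
  rw [depth, depth]
  linarith

theorem radiusSq_anti (hδ : 0 < δ) (hη : 0 < η) (h : depth s R z t ≤ depth s R z' t') :
    radiusSq s R δ η z' t' ≤ radiusSq s R δ η z t := by
  have h1 := expNegInvGlue.monotone (div_le_div_of_nonneg_right h hδ.le)
  have h2 := inv_nonneg.2 (expNegInvGlue.nonneg (1 / 4))
  have h3 := mul_le_mul_of_nonneg_left h1 h2
  exact mul_le_mul_of_nonneg_left (by linarith) hη.le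

theorem depth_nonpos_of_capCoord (h : 1 ≤ capCoord s R z) : depth s R z t ≤ 0 := by
  have h1 := expNegInvGlue.monotone h
  have h2 := expNegInvGlue.nonneg (1 / 2 - t)
  rw [depth]
  linarith

theorem depth_nonpos_of_time (h : t ≤ -(1 / 2)) : depth s R z t ≤ 0 := by
  have h1 : expNegInvGlue 1 ≤ expNegInvGlue (1 / 2 - t) := expNegInvGlue.monotone (by linarith)
  have h2 := expNegInvGlue.nonneg (capCoord s R z)
  rw [depth]
  linarith

theorem depth_of_time_ge (h : 1 / 2 ≤ t) :
    depth s R z t = expNegInvGlue 1 - expNegInvGlue (capCoord s R z) := by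
  rw [depth, expNegInvGlue.zero_of_nonpos (by linarith : 1 / 2 - t ≤ 0), sub_zero]

/-- Both subtracted terms vanish, so the depth is E(1) ≥ δ/2, beyond the zero of r at depth δ/4. -/
theorem radiusSq_neg (hδ : 0 < δ) (hδE : δ ≤ 2 * expNegInvGlue 1) (hη : 0 < η)
    (hc : capCoord s R z ≤ 0) (ht : 1 / 2 ≤ t) : radiusSq s R δ η z t < 0 := by
  refine lt_of_not_ge fun h => ?_
  rw [radiusSq_nonneg_iff hη, depth_of_time_ge ht, expNegInvGlue.zero_of_nonpos hc,
    div_le_iff₀ hδ] at h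
  have := expNegInvGlue.pos_of_pos one_pos
  linarith

theorem capCoord_sin (hR : 0 < R) (θ : ℝ) :
    capCoord s R (R * Real.sin θ) = (1 + s - 2 * Real.sin θ) / (1 - s) := by
  rw [capCoord, mul_div_cancel_left₀ _ hR.ne']

theorem contDiff_radiusSq_sin (s R δ η : ℝ) :
    ContDiff ℝ ∞ (fun q : ℝ × ℝ => radiusSq s R δ η (R * Real.sin q.1) q.2) := by
  have hg : ContDiff ℝ ∞ (fun q : ℝ × ℝ => (R * Real.sin q.1, q.2)) :=
    (contDiff_const.mul (Real.contDiff_sin.comp contDiff_fst)).prodMk contDiff_snd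
  have h := ContDiff.comp (contDiff_radiusSq s R δ η) hg
  rwa [Function.comp_def] at h

theorem boundaryConditions_radiusSq {θ₀ : ℝ} (hθ₀ : 0 < θ₀) (hθ₀' : θ₀ < Real.pi / 2) (hR : 0 < R)
    (hδ : 0 < δ) (hδE : δ ≤ 2 * expNegInvGlue 1) (hη : 0 < η) :
    BoundaryConditions θ₀ (1 / 2) η
      (fun θ t => radiusSq (Real.sin θ₀) R δ η (R * Real.sin θ) t) := by
  set s := Real.sin θ₀ with hs
  have hs0 : 0 < s := Real.sin_pos_of_pos_of_lt_pi hθ₀ (by linarith [Real.pi_pos])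
  have hs1 : s < 1 := by
    rw [← Real.sin_pi_div_two]
    exact Real.sin_lt_sin_of_lt_of_le_pi_div_two (by linarith) le_rfl hθ₀'
  have h1s : 0 < 1 - s := by linarith
  have hout : ∀ θ ∈ latitudes, ∀ t, θ ≤ θ₀ ∨ t ≤ -(1 / 2) →
      radiusSq s R δ η (R * Real.sin θ) t = η := by
    rintro θ hθ t (h | h)
    · refine radiusSq_of_depth_nonpos hδ (depth_nonpos_of_capCoord ?_)
      have := Real.sin_le_sin_of_le_of_le_pi_div_two hθ.1 hθ₀'.le h
      rw [capCoord_sin hR, le_div_iff₀ h1s]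
      linarith
    · exact radiusSq_of_depth_nonpos hδ (depth_nonpos_of_time h)
  have hmono : MonotoneOn (fun θ => R * Real.sin θ) latitudes := fun a ha b hb hab =>
    mul_le_mul_of_nonneg_left (Real.sin_le_sin_of_le_of_le_pi_div_two ha.1 hb.2 hab) hR.le
  refine ⟨?_, hη, ?_, ?_, hout, ?_, ?_, ?_, ?_, ?_⟩
  · exact contDiff_radiusSq_sin s R δ η
  · intro θ hθ t t' ht ht'
    rw [hout θ hθ t (Or.inr ht.le), hout θ hθ t' (Or.inr ht'.le)]
  · intro θ hθ t t' ht ht'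
    simp only [radiusSq, depth_of_time_ge ht.le, depth_of_time_ge ht'.le]
  · refine ⟨Real.pi / 2 - Real.arcsin ((1 + s) / 2), ?_, ?_⟩
    · rw [gt_iff_lt, sub_pos, Real.arcsin_lt_pi_div_two]
      linarith
    · have h : ∀ θ ∈ latitudes, Real.pi / 2 - (Real.pi / 2 - Real.arcsin ((1 + s) / 2)) ≤ θ →
          expNegInvGlue (capCoord s R (R * Real.sin θ)) = 0 := by
        intro θ hθ h
        rw [sub_sub_cancel] at h
        have h2 := Real.sin_le_sin_of_le_of_le_pi_div_two (Real.neg_pi_div_two_le_arcsin _) hθ.2 h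
        rw [Real.sin_arcsin (by linarith) (by linarith)] at h2
        rw [capCoord_sin hR]
        exact expNegInvGlue.zero_of_nonpos
          (div_nonpos_of_nonpos_of_nonneg (by linarith) h1s.le)
      intro θ hθ θ' hθ' h1 h2 t
      simp only [radiusSq, depth, h θ hθ h1, h θ' hθ' h2]
  · intro t ht
    refine radiusSq_neg hδ hδE hη ?_ ht.le
    rw [capCoord_sin hR, Real.sin_pi_div_two]
    exact div_nonpos_of_nonpos_of_nonneg (by linarith) h1s.le
  · intro t a ha b hb hab
    exact radiusSq_anti hδ hη (depth_mono hs1 hR (hmono ha hb hab) le_rfl)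
  · intro θ hθ a b hab
    exact radiusSq_anti hδ hη (depth_mono hs1 hR le_rfl hab)
  · rintro θ hθ t ⟨ht, hθd, hr⟩
    have hd0 : 0 < depth s R (R * Real.sin θ) t := by
      by_contra h
      rw [radiusSq_of_depth_nonpos hδ (not_lt.1 h)] at hr
      exact hη.ne' hr
    have hp : 0 < radiusSlope s R δ η (R * Real.sin θ) t :=
      mul_pos (mul_pos (mul_pos hη (inv_pos.2 (expNegInvGlue.pos_of_pos (by norm_num))))
        (inv_pos.2 hδ)) (glueDeriv_pos (div_pos hd0 hδ))
    have hF := hasFDerivAt_radiusSq s R δ η (R * Real.sin θ, t)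
    have h1 := hF.comp_hasDerivAt t ((hasDerivAt_const t (R * Real.sin θ)).prodMk (hasDerivAt_id t))
    have h2 := hF.comp_hasDerivAt θ (((Real.hasDerivAt_sin θ).const_mul R).prodMk
      (hasDerivAt_const θ t))
    have h1' := h1.deriv.symm.trans ht
    have h2' := h2.deriv.symm.trans hθd
    have ht0 : 1 / 2 ≤ t := by
      by_contra h
      have := glueDeriv_pos (by linarith : 0 < 1 / 2 - t)
      simp [hp.ne'] at h1'
      rw [← one_div] at h1'
      exact this.ne' h1'
    have hc0 : capCoord s R (R * Real.sin θ) ≤ 0 := by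
      by_contra h
      have hg := glueDeriv_pos (not_le.1 h)
      have hcos : Real.cos θ = 0 := by
        simpa [hp.ne', depthDerivHeight, hg.ne', hR.ne', h1s.ne'] using h2'
      have hsin := Real.sin_sq_add_cos_sq θ
      rw [hcos] at hsin
      have : (Real.sin θ - 1) * (Real.sin θ + 1) = 0 := by linarith
      rcases mul_eq_zero.1 this with h3 | h3
      · refine h ?_
        rw [capCoord_sin hR]
        exact div_nonpos_of_nonpos_of_nonneg (by linarith) h1s.le
      · refine hd0.not_ge (depth_nonpos_of_capCoord ?_)
        rw [capCoord_sin hR, le_div_iff₀ h1s]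
        linarith
    exact (radiusSq_neg hδ hδE hη hc0 ht0).ne hr

theorem latitude_mem_latitudes (p : EuclideanSpace ℝ (Fin 6)) : latitude p ∈ latitudes :=
  ⟨Real.neg_pi_div_two_le_arcsin _, Real.arcsin_le_pi_div_two _⟩

theorem mul_sin_latitude (hR : 0 < R) {p : EuclideanSpace ℝ (Fin 6)}
    (hp : p 0 ^ 2 + p 1 ^ 2 + p 2 ^ 2 = R ^ 2) : R * Real.sin (latitude p) = p 2 := by
  have hz : p 2 ^ 2 ≤ R ^ 2 := by nlinarith [sq_nonneg (p 0), sq_nonneg (p 1)]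
  have h1 := abs_le.1 (abs_le_of_sq_le_sq hz hR.le)
  rw [latitude, hp, Real.sqrt_sq hR.le, Real.sin_arcsin, mul_div_cancel₀ _ hR.ne']
  · rw [le_div_iff₀ hR]
    linarith
  · rw [div_le_one hR]
    exact h1.2

/-- On the sphere R sin θ is the height. Working with z instead of θ removes the singularity of
latitude at the poles. -/
theorem cobordism_eq_circleBundle (hR : 0 < R) (F : ℝ → ℝ → ℝ) :
    cobordism R (fun θ t => F (R * Real.sin θ) t) = circleBundle R F := by
  ext p
  refine and_congr_right fun hp => ?_
  simp only [mul_sin_latitude hR hp]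

theorem hasCylindricalEnds_cobordism {θ₀ T r₀ : ℝ} {r : ℝ → ℝ → ℝ}
    (h : BoundaryConditions θ₀ T r₀ r) : HasCylindricalEnds R θ₀ T r₀ (cobordism R r) := by
  constructor
  · intro p hp
    refine and_congr_right fun _ => ?_
    rw [h.const_outside _ (latitude_mem_latitudes p) _ hp.symm]
  · intro p q hpq hp hq
    have hlat : latitude p = latitude q := by
      rw [latitude, latitude, hpq 0 (by decide), hpq 1 (by decide), hpq 2 (by decide)]
    rw [cobordism, Set.mem_ofPred_eq, Set.mem_ofPred_eq, hlat, hpq 0 (by decide), hpq 1 (by decide),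
      hpq 2 (by decide), hpq 3 (by decide), hpq 4 (by decide),
      h.const_after _ (latitude_mem_latitudes q) _ _ hp hq]

end Boundary

/-! ### The handle -/

/-- A function on the quadrant that is negative at the origin, equal to `1` outside the unit
square, and increases along rays. -/
structure IsRayProfile (H : ℝ → ℝ → ℝ) : Prop where
  continuous : Continuous (fun q : ℝ × ℝ => H q.1 q.2)
  mono : ∀ {x x' y y'}, x ≤ x' → y ≤ y' → H x y ≤ H x' y'
  le_one : ∀ x y, H x y ≤ 1
  eq_one : ∀ {x y}, 1 ≤ x ∨ 1 ≤ y → H x y = 1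
  neg_zero : H 0 0 < 0
  pos_of_zero : ∀ {x y κ}, 0 ≤ x → 0 ≤ y → 1 < κ → H x y = 0 → 0 < H (κ * x) (κ * y)

namespace IsRayProfile

variable {H : ℝ → ℝ → ℝ} (hH : IsRayProfile H)
include hH

theorem sum_pos {x y : ℝ} (hx : 0 ≤ x) (hy : 0 ≤ y) (h : 0 ≤ H x y) : 0 < x + y := by
  rcases hx.eq_or_lt with rfl | hx
  · rcases hy.eq_or_lt with rfl | hy
    · exact absurd h hH.neg_zero.not_ge
    · linarith
  · linarith

/-- With m = max(β, 1 - β), the point (β/m, (1 - β)/m) is where the ray of direction (β, 1 - β)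
leaves the unit square. Scaled by k it has maximum k, and the intermediate value theorem is applied
in k. -/
theorem exists_ray {β ρ : ℝ} (hβ0 : 0 ≤ β) (hβ1 : β ≤ 1) (hρ0 : 0 ≤ ρ) (hρ1 : ρ ≤ 1) :
    ∃ x y, 0 ≤ x ∧ x ≤ 1 ∧ 0 ≤ y ∧ y ≤ 1 ∧ 0 ≤ H x y ∧ x = β * (x + y) ∧
      max x y ^ 2 * H x y = ρ := by
  set m := max β (1 - β) with hm
  have hβm : β ≤ m := le_max_left _ _
  have hβm' : 1 - β ≤ m := le_max_right _ _
  have hm0 : 0 < m := by linarith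
  have hc : Continuous fun k : ℝ => H (k * (β / m)) (k * ((1 - β) / m)) :=
    hH.continuous.comp (by fun_prop : Continuous fun k : ℝ => (k * (β / m), k * ((1 - β) / m)))
  have h1 : H (1 * (β / m)) (1 * ((1 - β) / m)) = 1 := by
    refine hH.eq_one ?_
    rw [one_mul, one_mul, one_le_div hm0, one_le_div hm0]
    exact le_max_iff.1 le_rfl
  have hmax : ∀ k, 0 ≤ k → max (k * (β / m)) (k * ((1 - β) / m)) = k := fun k hk => by
    rw [← mul_max_of_nonneg _ _ hk, max_div_div_right hm0.le, ← hm, div_self hm0.ne', mul_one]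
  have key : ∃ k, 0 ≤ k ∧ k ≤ 1 ∧ 0 ≤ H (k * (β / m)) (k * ((1 - β) / m)) ∧
      k ^ 2 * H (k * (β / m)) (k * ((1 - β) / m)) = ρ := by
    -- For ρ = 0 the function k² H has the spurious zero k = 0, where H < 0, so the theorem is
    -- applied to H itself.
    rcases hρ0.eq_or_lt with rfl | hρ
    · obtain ⟨k, ⟨hk0, hk1⟩, hk⟩ := intermediate_value_Icc (zero_le_one' ℝ) hc.continuousOn
        (show (0 : ℝ) ∈ Set.Icc _ _ from ⟨by simpa using hH.neg_zero.le, by simp only [h1]; norm_num⟩)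
      exact ⟨k, hk0, hk1, hk.ge, by rw [show H _ _ = 0 from hk, mul_zero]⟩
    · obtain ⟨k, ⟨hk0, hk1⟩, hk⟩ := intermediate_value_Icc (zero_le_one' ℝ)
        ((continuous_id.pow 2).mul hc).continuousOn
        (show ρ ∈ Set.Icc _ _ from ⟨by simpa using hρ0, by simp [-one_mul, h1, hρ1]⟩)
      have hk' : k ^ 2 * H (k * (β / m)) (k * ((1 - β) / m)) = ρ := hk
      refine ⟨k, hk0, hk1, ?_, hk'⟩
      by_contra hneg
      have := mul_nonpos_of_nonneg_of_nonpos (sq_nonneg k) (not_le.1 hneg).le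
      linarith
  obtain ⟨k, hk0, hk1, hkH, hkρ⟩ := key
  have hx : 0 ≤ β / m := by positivity
  have hy : 0 ≤ (1 - β) / m := div_nonneg (by linarith) hm0.le
  refine ⟨_, _, mul_nonneg hk0 hx, ?_, mul_nonneg hk0 hy, ?_, hkH, ?_, by rw [hmax k hk0, hkρ]⟩
  · exact (le_max_left _ _).trans ((hmax k hk0).le.trans hk1)
  · exact (le_max_right _ _).trans ((hmax k hk0).le.trans hk1)
  · field_simp
    ring

/-- Moving outward by κ > 1 multiplies max² by κ² and does not decrease H, so the product grows
strictly if H > 0. If H = 0, the field `pos_of_zero` makes it positive. -/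
theorem ray_not_lt {β ρ x y x' y' : ℝ} (hx : 0 ≤ x) (hy : 0 ≤ y) (h : 0 ≤ H x y)
    (hβ : x = β * (x + y)) (hβ' : x' = β * (x' + y')) (hρ : max x y ^ 2 * H x y = ρ)
    (hρ' : max x' y' ^ 2 * H x' y' = ρ) : ¬ x + y < x' + y' := by
  intro hlt
  have hs := hH.sum_pos hx hy h
  set κ := (x' + y') / (x + y) with hκ
  have hκ1 : 1 < κ := (one_lt_div hs).2 hlt
  have hκs : κ * (x + y) = x' + y' := div_mul_cancel₀ _ hs.ne'
  have hx' : x' = κ * x := by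
    rw [hβ', hβ, ← hκs]
    ring
  have hy' : y' = κ * y := by linarith
  have hmax : max x' y' = κ * max x y := by
    rw [hx', hy', mul_max_of_nonneg _ _ (by linarith)]
  have hm0 : 0 < max x y := by
    by_contra hneg
    have h1 := le_max_left x y
    have h2 := le_max_right x y
    linarith
  have hmono : H x y ≤ H x' y' := hH.mono (by rw [hx']; nlinarith) (by rw [hy']; nlinarith)
  rw [← hρ, hmax, mul_pow] at hρ'
  have hm2 : 0 < max x y ^ 2 := by positivity
  have hκ2 : 1 < κ ^ 2 := one_lt_pow₀ hκ1 two_ne_zero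
  have hE : κ ^ 2 * H x' y' = H x y := by
    have : max x y ^ 2 * (κ ^ 2 * H x' y') = max x y ^ 2 * H x y := by linarith
    exact mul_left_cancel₀ hm2.ne' this
  rcases h.eq_or_lt with h0 | h0
  · have := hH.pos_of_zero hx hy hκ1 h0.symm
    rw [← hx', ← hy'] at this
    have : 0 < κ ^ 2 * H x' y' := by positivity
    linarith
  · nlinarith

theorem ray_unique {β ρ x y x' y' : ℝ} (hx : 0 ≤ x) (hy : 0 ≤ y) (h : 0 ≤ H x y)
    (hx' : 0 ≤ x') (hy' : 0 ≤ y') (h' : 0 ≤ H x' y')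
    (hβ : x = β * (x + y)) (hβ' : x' = β * (x' + y')) (hρ : max x y ^ 2 * H x y = ρ)
    (hρ' : max x' y' ^ 2 * H x' y' = ρ) : x = x' ∧ y = y' := by
  have h1 := hH.ray_not_lt hx hy h hβ hβ' hρ hρ'
  have h2 := hH.ray_not_lt hx' hy' h' hβ' hβ hρ' hρ
  have h3 : x + y = x' + y' := le_antisymm (not_lt.1 h2) (not_lt.1 h1)
  have h4 : x = x' := by rw [hβ, hβ', h3]
  exact ⟨h4, by linarith⟩

theorem max_sq_mul_eq_one_iff {x y : ℝ} (hx0 : 0 ≤ x) (hx : x ≤ 1) (hy : y ≤ 1) :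
    max x y ^ 2 * H x y = 1 ↔ x = 1 ∨ y = 1 := by
  constructor
  · intro h
    by_contra hne
    rw [not_or] at hne
    have h1 : max x y < 1 := max_lt (lt_of_le_of_ne hx hne.1) (lt_of_le_of_ne hy hne.2)
    have h2 : 0 ≤ max x y := hx0.trans (le_max_left _ _)
    have h3 := hH.le_one x y
    have h4 : max x y ^ 2 < 1 := pow_lt_one₀ h2 h1 two_ne_zero
    nlinarith [sq_nonneg (max x y)]
  · rintro (rfl | rfl)
    · rw [hH.eq_one (Or.inl le_rfl), max_eq_left hy]
      norm_num
    · rw [hH.eq_one (Or.inr le_rfl), max_eq_right hx]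
      norm_num

end IsRayProfile

/-- `radiusSq`, normalized, in coordinates in which the cap and the time interval become the unit
interval. -/
def normalizedRadiusSq (δ x y : ℝ) : ℝ :=
  1 - (expNegInvGlue (1 / 4))⁻¹ *
    expNegInvGlue ((expNegInvGlue 1 - expNegInvGlue (2 * x - 1) - expNegInvGlue y) / δ)

theorem radiusSq_eq_normalizedRadiusSq {s R δ η z t : ℝ} (hs : s < 1) :
    radiusSq s R δ η z t = η * normalizedRadiusSq δ ((1 - z / R) / (1 - s)) (1 / 2 - t) := by
  have h : capCoord s R z = 2 * ((1 - z / R) / (1 - s)) - 1 := by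
    have : 1 - s ≠ 0 := by linarith
    rw [capCoord]
    field_simp
    ring
  rw [radiusSq, depth, h, normalizedRadiusSq]

theorem isRayProfile_normalizedRadiusSq {δ : ℝ} (hδ : 0 < δ) (hδE : δ ≤ 2 * expNegInvGlue 1) :
    IsRayProfile (normalizedRadiusSq δ) := by
  have hE4 := expNegInvGlue.pos_of_pos (by norm_num : (0 : ℝ) < 1 / 4)
  have hE1 := expNegInvGlue.pos_of_pos one_pos
  have hmem : ∀ {x : ℝ}, 0 ≤ x → x ∈ Set.Ici (0 : ℝ) := fun h => h
  refine ⟨?_, ?_, ?_, ?_, ?_, ?_⟩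
  · have hE : Continuous expNegInvGlue := (expNegInvGlue.contDiff (n := 0)).continuous
    unfold normalizedRadiusSq
    fun_prop
  · intro x x' y y' hx hy
    have h1 : expNegInvGlue (2 * x - 1) ≤ expNegInvGlue (2 * x' - 1) :=
      expNegInvGlue.monotone (by linarith)
    have h2 := expNegInvGlue.monotone hy
    refine sub_le_sub_left (mul_le_mul_of_nonneg_left (expNegInvGlue.monotone
      (div_le_div_of_nonneg_right ?_ hδ.le)) (inv_pos.2 hE4).le) 1
    linarith
  · intro x y
    exact sub_le_self _ (mul_nonneg (inv_pos.2 hE4).le (expNegInvGlue.nonneg _))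
  · intro x y h
    have h0 : expNegInvGlue 1 - expNegInvGlue (2 * x - 1) - expNegInvGlue y ≤ 0 := by
      have h1 := expNegInvGlue.nonneg (2 * x - 1)
      have h2 := expNegInvGlue.nonneg y
      rcases h with h | h
      · have := expNegInvGlue.monotone (by linarith : 1 ≤ 2 * x - 1)
        linarith
      · have := expNegInvGlue.monotone h
        linarith
    rw [normalizedRadiusSq, expNegInvGlue.zero_of_nonpos (div_nonpos_of_nonpos_of_nonneg h0 hδ.le)]
    ring
  · have h0 : expNegInvGlue (2 * 0 - 1) = 0 := expNegInvGlue.zero_of_nonpos (by norm_num)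
    have h1 : (1 : ℝ) / 4 < expNegInvGlue 1 / δ := by
      rw [lt_div_iff₀ hδ]
      linarith
    have h2 := strictMonoOn_expNegInvGlue (hmem (by norm_num)) (hmem (by positivity)) h1
    rw [normalizedRadiusSq, h0, expNegInvGlue.zero, sub_zero, sub_zero, sub_neg,
      one_lt_inv_mul₀ hE4]
    exact h2
  · intro x y κ hx hy hκ h
    have h1 : expNegInvGlue ((expNegInvGlue 1 - expNegInvGlue (2 * x - 1) - expNegInvGlue y) / δ)
        = expNegInvGlue (1 / 4) := by
      rw [normalizedRadiusSq, sub_eq_zero] at h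
      field_simp at h
      exact h.symm
    have hpos : 0 < (expNegInvGlue 1 - expNegInvGlue (2 * x - 1) - expNegInvGlue y) / δ := by
      by_contra hneg
      rw [expNegInvGlue.zero_of_nonpos (not_lt.1 hneg)] at h1
      linarith
    have h2 : (expNegInvGlue 1 - expNegInvGlue (2 * x - 1) - expNegInvGlue y) / δ = 1 / 4 :=
      strictMonoOn_expNegInvGlue.injOn (hmem hpos.le) (hmem (by norm_num)) h1
    have hxκ : x ≤ κ * x := le_mul_of_one_le_left hx hκ.le
    have hyκ : y ≤ κ * y := le_mul_of_one_le_left hy hκ.le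
    have hmx : expNegInvGlue (2 * x - 1) ≤ expNegInvGlue (2 * (κ * x) - 1) :=
      expNegInvGlue.monotone (by linarith)
    have hmy := expNegInvGlue.monotone hyκ
    have hlt : expNegInvGlue (2 * x - 1) + expNegInvGlue y <
        expNegInvGlue (2 * (κ * x) - 1) + expNegInvGlue (κ * y) := by
      -- Scaling strictly raises whichever of the two terms is positive. If y = 0 then 2x - 1 > 0,
      -- since otherwise the depth would be E(1), and E(1)/δ ≥ 1/2 is not 1/4.
      rcases le_or_gt y 0 with hy0 | hy0
      · have hx1 : 0 < 2 * x - 1 := by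
          by_contra hneg
          rw [expNegInvGlue.zero_of_nonpos (not_lt.1 hneg), expNegInvGlue.zero_of_nonpos hy0,
            sub_zero, sub_zero, div_eq_iff hδ.ne'] at h2
          linarith
        have := strictMonoOn_expNegInvGlue (hmem hx1.le)
          (hmem (by linarith : 0 ≤ 2 * (κ * x) - 1)) (by nlinarith)
        linarith
      · have := strictMonoOn_expNegInvGlue (hmem hy) (hmem (hy.trans hyκ))
          (lt_mul_of_one_lt_left hy0 hκ)
        linarith
    have h3 : (expNegInvGlue 1 - expNegInvGlue (2 * (κ * x) - 1) - expNegInvGlue (κ * y)) / δ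
        < 1 / 4 := by
      rw [← h2]
      exact div_lt_div_of_pos_right (by linarith) hδ
    have h4 : expNegInvGlue
        ((expNegInvGlue 1 - expNegInvGlue (2 * (κ * x) - 1) - expNegInvGlue (κ * y)) / δ)
        < expNegInvGlue (1 / 4) := by
      rcases le_or_gt ((expNegInvGlue 1 - expNegInvGlue (2 * (κ * x) - 1)
        - expNegInvGlue (κ * y)) / δ) 0 with h0 | h0
      · rw [expNegInvGlue.zero_of_nonpos h0]
        exact hE4
      · exact strictMonoOn_expNegInvGlue (hmem h0.le) (hmem (by norm_num)) h3
    rw [normalizedRadiusSq, sub_pos, inv_mul_lt_one₀ hE4]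
    exact h4

/-! ### The homeomorphism with D² × D². -/

section Handle

variable {s R η : ℝ} {H : ℝ → ℝ → ℝ}

/-- The distance from the pole, measured by height and normalized to `1` on the boundary of the
cap. -/
def capRadius (s R : ℝ) (p : EuclideanSpace ℝ (Fin 6)) : ℝ := (1 - p 2 / R) / (1 - s)

/-- The part of a circle bundle over the cap `z ≥ s R` and times in `[-1/2, 1/2]`. -/
def capBundle (s R η : ℝ) (H : ℝ → ℝ → ℝ) : Set (EuclideanSpace ℝ (Fin 6)) :=
  {p | p 0 ^ 2 + p 1 ^ 2 + p 2 ^ 2 = R ^ 2 ∧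
    p 3 ^ 2 + p 4 ^ 2 = η * H (capRadius s R p) (1 / 2 - p 5) ∧
    s * R ≤ p 2 ∧ -(1 / 2) ≤ p 5 ∧ p 5 ≤ 1 / 2}

/-- The factor by which the coordinates `(x, y)` are divided. -/
def capScale (s R : ℝ) (p : EuclideanSpace ℝ (Fin 6)) : ℝ :=
  R * √((1 + p 2 / R) * (1 - s) * (capRadius s R p + (1 / 2 - p 5)))

/-- The disk coordinate coming from the circle factor. -/
def fiberCoord (s R η : ℝ) (p : EuclideanSpace ℝ (Fin 6)) : EuclideanSpace ℝ (Fin 2) :=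
  (max (capRadius s R p) (1 / 2 - p 5) / √η) • !₂[p 3, p 4]

/-- The disk coordinate coming from the cap and the time. -/
def baseCoord (s R : ℝ) (p : EuclideanSpace ℝ (Fin 6)) : EuclideanSpace ℝ (Fin 2) :=
  (capScale s R p)⁻¹ • !₂[p 0, p 1]

theorem continuous_capRadius : Continuous (capRadius s R) := by
  unfold capRadius
  fun_prop

theorem isCompact_capBundle (hη : 0 ≤ η) (hH : IsRayProfile H) :
    IsCompact (capBundle s R η H) := by
  refine Metric.isCompact_of_isClosed_isBounded ?_ ?_
  · have hc : Continuous fun p : EuclideanSpace ℝ (Fin 6) => H (capRadius s R p) (1 / 2 - p 5) :=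
      hH.continuous.comp (continuous_capRadius.prodMk (by fun_prop))
    have e1 : IsClosed {p : EuclideanSpace ℝ (Fin 6) | p 0 ^ 2 + p 1 ^ 2 + p 2 ^ 2 = R ^ 2} :=
      isClosed_eq (by fun_prop) (by fun_prop)
    have e2 : IsClosed {p : EuclideanSpace ℝ (Fin 6) | p 3 ^ 2 + p 4 ^ 2 =
        η * H (capRadius s R p) (1 / 2 - p 5)} :=
      isClosed_eq (by fun_prop) (continuous_const.mul hc)
    have e3 : IsClosed {p : EuclideanSpace ℝ (Fin 6) | s * R ≤ p 2} :=
      isClosed_le (by fun_prop) (by fun_prop)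
    have e4 : IsClosed {p : EuclideanSpace ℝ (Fin 6) | -(1 / 2) ≤ p 5} :=
      isClosed_le (by fun_prop) (by fun_prop)
    have e5 : IsClosed {p : EuclideanSpace ℝ (Fin 6) | p 5 ≤ 1 / 2} :=
      isClosed_le (by fun_prop) (by fun_prop)
    exact e1.inter (e2.inter (e3.inter (e4.inter e5)))
  · refine (Metric.isBounded_closedBall (x := (0 : EuclideanSpace ℝ (Fin 6)))
      (r := √(R ^ 2 + η + 1))).subset ?_
    rintro p ⟨h1, h2, -, h4, h5⟩
    rw [mem_closedBall_zero_iff, EuclideanSpace.norm_eq]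
    refine Real.sqrt_le_sqrt ?_
    simp only [Fin.sum_univ_six, Real.norm_eq_abs, sq_abs]
    have h6 := mul_le_mul_of_nonneg_left (hH.le_one (capRadius s R p) (1 / 2 - p 5)) hη
    nlinarith

theorem norm_sq_smul_pair (c u v : ℝ) : ‖c • (!₂[u, v] : EuclideanSpace ℝ (Fin 2))‖ ^ 2 =
    c ^ 2 * (u ^ 2 + v ^ 2) := by
  rw [EuclideanSpace.norm_sq_eq]
  simp only [Fin.sum_univ_two, Real.norm_eq_abs, sq_abs]
  simp
  ring

variable (hs0 : 0 < s) (hs1 : s < 1) (hR : 0 < R) (hη : 0 < η) (hH : IsRayProfile H)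

include hs1 in
theorem height_div_eq (p : EuclideanSpace ℝ (Fin 6)) :
    p 2 / R = 1 - (1 - s) * capRadius s R p := by
  have : 1 - s ≠ 0 := by linarith
  rw [capRadius]
  field_simp
  ring

include hs1 hR in
theorem capRadius_mem {p : EuclideanSpace ℝ (Fin 6)} (hp : p ∈ capBundle s R η H) :
    0 ≤ capRadius s R p ∧ capRadius s R p ≤ 1 ∧ s ≤ p 2 / R := by
  obtain ⟨h1, -, h3, -⟩ := hp
  have h1s : 0 < 1 - s := by linarith
  have hz : p 2 ^ 2 ≤ R ^ 2 := by nlinarith [sq_nonneg (p 0), sq_nonneg (p 1)]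
  have hz1 : p 2 / R ≤ 1 := (div_le_one hR).2 (abs_le.1 (abs_le_of_sq_le_sq hz hR.le)).2
  have hz0 : s ≤ p 2 / R := (le_div_iff₀ hR).2 h3
  refine ⟨div_nonneg (by linarith) h1s.le, ?_, hz0⟩
  rw [capRadius, div_le_one h1s]
  linarith

include hs0 hs1 hR hη hH in
-- H < 0 at the origin keeps the bundle off the pole at the final time, so the divisor of the base
-- coordinate and the weight of the fiber coordinate are positive.
theorem capBundle_facts {p : EuclideanSpace ℝ (Fin 6)} (hp : p ∈ capBundle s R η H) :
    0 ≤ H (capRadius s R p) (1 / 2 - p 5) ∧ 0 < capRadius s R p + (1 / 2 - p 5) ∧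
      0 < max (capRadius s R p) (1 / 2 - p 5) ∧ 0 < capScale s R p ∧
      capScale s R p ^ 2 = R ^ 2 * ((1 + p 2 / R) * (1 - s) * (capRadius s R p + (1 / 2 - p 5))) := by
  obtain ⟨hx0, hx1, hz⟩ := capRadius_mem hs1 hR hp
  obtain ⟨-, h2, -, -, h5⟩ := hp
  have h1s : 0 < 1 - s := by linarith
  have hH0 : 0 ≤ H (capRadius s R p) (1 / 2 - p 5) := by
    refine nonneg_of_mul_nonneg_right ?_ hη
    rw [← h2]
    positivity
  have hsum := hH.sum_pos hx0 (by linarith) hH0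
  have hpos : 0 < (1 + p 2 / R) * (1 - s) * (capRadius s R p + (1 / 2 - p 5)) :=
    mul_pos (mul_pos (by linarith) h1s) hsum
  refine ⟨hH0, hsum, ?_, mul_pos hR (Real.sqrt_pos.2 hpos), ?_⟩
  · by_contra hneg
    have h1 := le_max_left (capRadius s R p) (1 / 2 - p 5)
    have h2 := le_max_right (capRadius s R p) (1 / 2 - p 5)
    linarith
  · rw [capScale, mul_pow, Real.sq_sqrt hpos.le]

include hη in
theorem norm_sq_fiberCoord {p : EuclideanSpace ℝ (Fin 6)} (hp : p ∈ capBundle s R η H) :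
    ‖fiberCoord s R η p‖ ^ 2 = max (capRadius s R p) (1 / 2 - p 5) ^ 2 *
      H (capRadius s R p) (1 / 2 - p 5) := by
  rw [fiberCoord, norm_sq_smul_pair, hp.2.1, div_pow, Real.sq_sqrt hη.le]
  field_simp

include hs0 hs1 hR hη hH in
-- On the sphere p₀² + p₁² = R² (1 + z/R)(1 - z/R), and 1 - z/R is (1 - s) times `capRadius`.
-- Dividing by the square of `capScale` leaves the ray direction x/(x + y).
theorem norm_sq_baseCoord {p : EuclideanSpace ℝ (Fin 6)} (hp : p ∈ capBundle s R η H) :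
    capRadius s R p = ‖baseCoord s R p‖ ^ 2 * (capRadius s R p + (1 / 2 - p 5)) := by
  obtain ⟨-, hsum, -, hpos, hsq⟩ := capBundle_facts hs0 hs1 hR hη hH hp
  obtain ⟨hx0, hx1, hz⟩ := capRadius_mem hs1 hR hp
  have hxy : p 0 ^ 2 + p 1 ^ 2 = R ^ 2 * ((1 + p 2 / R) * (1 - s) * capRadius s R p) := by
    have h1 := height_div_eq (R := R) hs1 p
    have h2 : (1 - s) * capRadius s R p = 1 - p 2 / R := by linarith
    rw [mul_assoc (1 + p 2 / R), h2]
    have h3 : R ^ 2 * ((1 + p 2 / R) * (1 - p 2 / R)) = R ^ 2 - p 2 ^ 2 := by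
      field_simp
      ring
    rw [h3, ← hp.1]
    ring
  have h1 : 0 < 1 + p 2 / R := by linarith
  have h2 : 0 < 1 - s := by linarith
  rw [baseCoord, norm_sq_smul_pair, inv_pow, hsq, hxy]
  generalize 1 + p 2 / R = u at h1 ⊢
  generalize hS : capRadius s R p + (1 / 2 - p 5) = S at hsum ⊢
  field_simp

include hs0 hs1 hR hη hH in
theorem norm_baseCoord_le {p : EuclideanSpace ℝ (Fin 6)} (hp : p ∈ capBundle s R η H) :
    ‖baseCoord s R p‖ ≤ 1 := by
  have h := norm_sq_baseCoord hs0 hs1 hR hη hH hp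
  have hsum := (capBundle_facts hs0 hs1 hR hη hH hp).2.1
  have h5 := hp.2.2.2.2
  by_contra hneg
  have : 1 < ‖baseCoord s R p‖ ^ 2 := one_lt_pow₀ (not_le.1 hneg) two_ne_zero
  nlinarith

include hs0 hs1 hR hη hH in
theorem norm_fiberCoord_le {p : EuclideanSpace ℝ (Fin 6)} (hp : p ∈ capBundle s R η H) :
    ‖fiberCoord s R η p‖ ≤ 1 := by
  have h := norm_sq_fiberCoord hη hp
  obtain ⟨hH0, -, hm, -⟩ := capBundle_facts hs0 hs1 hR hη hH hp
  obtain ⟨hx0, hx1, hz⟩ := capRadius_mem hs1 hR hp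
  have hy : 1 / 2 - p 5 ≤ 1 := by linarith [hp.2.2.2.1]
  have h1 : max (capRadius s R p) (1 / 2 - p 5) ^ 2 ≤ 1 := pow_le_one₀ hm.le (max_le hx1 hy)
  have h2 := mul_le_one₀ h1 hH0 (hH.le_one _ _)
  rw [← h] at h2
  exact (sq_le_one_iff₀ (norm_nonneg _)).1 h2

include hs0 hs1 hR hη hH in
/-- A point of the bundle over the cap is determined by the normalized radius of the circle and the
base coordinate up to its position on the circle. -/
theorem capRadius_eq_of_baseCoord_eq {p q : EuclideanSpace ℝ (Fin 6)} (hp : p ∈ capBundle s R η H)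
    (hq : q ∈ capBundle s R η H) (hb : baseCoord s R p = baseCoord s R q)
    (ha : ‖fiberCoord s R η p‖ = ‖fiberCoord s R η q‖) :
    capRadius s R p = capRadius s R q ∧ p 0 = q 0 ∧ p 1 = q 1 ∧ p 2 = q 2 ∧ p 5 = q 5 := by
  have hbp := norm_sq_baseCoord hs0 hs1 hR hη hH hp
  have hbq := norm_sq_baseCoord hs0 hs1 hR hη hH hq
  have hap := norm_sq_fiberCoord hη hp
  have haq := norm_sq_fiberCoord hη hq
  rw [← hb] at hbq
  rw [← ha] at haq
  obtain ⟨hx, hy⟩ := hH.ray_unique (capRadius_mem hs1 hR hp).1 (by linarith [hp.2.2.2.2])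
    (capBundle_facts hs0 hs1 hR hη hH hp).1 (capRadius_mem hs1 hR hq).1
    (by linarith [hq.2.2.2.2]) (capBundle_facts hs0 hs1 hR hη hH hq).1 hbp hbq hap.symm haq.symm
  have hz : p 2 = q 2 := by
    have h1 := height_div_eq (R := R) hs1 p
    have h2 := height_div_eq (R := R) hs1 q
    rw [hx, ← h2] at h1
    exact (div_left_inj' hR.ne').1 h1
  have ht : p 5 = q 5 := by linarith
  have hsc : capScale s R p = capScale s R q := by rw [capScale, capScale, hx, hz, ht]
  have hpos := (capBundle_facts hs0 hs1 hR hη hH hp).2.2.2.1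
  have hsm : (!₂[p 0, p 1] : EuclideanSpace ℝ (Fin 2)) = !₂[q 0, q 1] := by
    rw [baseCoord, baseCoord, ← hsc] at hb
    exact smul_right_injective _ (inv_ne_zero hpos.ne') hb
  exact ⟨hx, by simpa using congrArg (fun v => v 0) hsm, by simpa using congrArg (fun v => v 1) hsm,
    hz, ht⟩

include hs0 hs1 hR hη hH in
theorem exists_mem_capBundle {a b : EuclideanSpace ℝ (Fin 2)} (ha : ‖a‖ ≤ 1) (hb : ‖b‖ ≤ 1) :
    ∃ p ∈ capBundle s R η H, fiberCoord s R η p = a ∧ baseCoord s R p = b := by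
  -- The norms of b and a pick the ray and the position on it, which fixes height and time;
  -- rescaling b and a then gives the other coordinates.
  obtain ⟨x, y, hx0, hx1, hy0, hy1, hH0, hxβ, hρ⟩ := hH.exists_ray (sq_nonneg ‖b‖)
    (pow_le_one₀ (norm_nonneg _) hb) (sq_nonneg ‖a‖) (pow_le_one₀ (norm_nonneg _) ha)
  have h1s : 0 < 1 - s := by linarith
  have hsum := hH.sum_pos hx0 hy0 hH0
  have hm : 0 < max x y := by
    by_contra hneg
    have h1 := le_max_left x y
    have h2 := le_max_right x y
    linarith
  have hz : 0 < 2 - (1 - s) * x := by nlinarith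
  set c := R * √((2 - (1 - s) * x) * (1 - s) * (x + y)) with hc
  have hc2 : c ^ 2 = R ^ 2 * ((2 - (1 - s) * x) * (1 - s) * (x + y)) := by
    rw [hc, mul_pow, Real.sq_sqrt (by positivity)]
  have hc0 : 0 < c := by positivity
  set d := √η / max x y with hd
  have hd2 : d ^ 2 = η / max x y ^ 2 := by rw [hd, div_pow, Real.sq_sqrt hη.le]
  have hη' : 0 < √η := Real.sqrt_pos.2 hη
  have hnorm : ∀ v : EuclideanSpace ℝ (Fin 2), v 0 ^ 2 + v 1 ^ 2 = ‖v‖ ^ 2 := fun v => by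
    rw [EuclideanSpace.norm_sq_eq]
    simp [Fin.sum_univ_two]
  let p : EuclideanSpace ℝ (Fin 6) :=
    !₂[c * b 0, c * b 1, R * (1 - (1 - s) * x), d * a 0, d * a 1, 1 / 2 - y]
  have p0 : p 0 = c * b 0 := rfl
  have p1 : p 1 = c * b 1 := rfl
  have p2 : p 2 = R * (1 - (1 - s) * x) := rfl
  have p3 : p 3 = d * a 0 := rfl
  have p4 : p 4 = d * a 1 := rfl
  have p5 : p 5 = 1 / 2 - y := rfl
  have hpz : p 2 / R = 1 - (1 - s) * x := by rw [p2, mul_div_cancel_left₀ _ hR.ne']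
  have hpx : capRadius s R p = x := by
    rw [capRadius, hpz]
    field_simp
    ring
  have hpy : 1 / 2 - p 5 = y := by
    rw [p5]
    ring
  have hpc : capScale s R p = c := by
    rw [capScale, hpx, hpy, hpz, hc]
    ring_nf
  refine ⟨p, ⟨?_, ?_, ?_, ?_, ?_⟩, ?_, ?_⟩
  · have h1 : p 0 ^ 2 + p 1 ^ 2 = c ^ 2 * ‖b‖ ^ 2 := by
      rw [p0, p1, ← hnorm]
      ring
    rw [h1, hc2, p2]
    linear_combination -(R ^ 2 * (2 - (1 - s) * x) * (1 - s)) * hxβ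
  · rw [hpx, hpy, p3, p4]
    have h1 : (d * a 0) ^ 2 + (d * a 1) ^ 2 = d ^ 2 * ‖a‖ ^ 2 := by
      rw [← hnorm]
      ring
    rw [h1, hd2, ← hρ]
    field_simp
  · rw [p2]
    nlinarith [mul_nonneg (mul_nonneg hR.le h1s.le) (sub_nonneg.2 hx1)]
  · rw [p5]
    linarith
  · rw [p5]
    linarith
  · rw [fiberCoord, hpx, hpy, p3, p4]
    ext i
    fin_cases i
    · simp [hd]
      field_simp
    · simp [hd]
      field_simp
  · rw [baseCoord, hpc, p0, p1]
    ext i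
    fin_cases i
    · simp [hc0.ne']
    · simp [hc0.ne']

theorem continuous_fiberCoord : Continuous (fiberCoord s R η) := by
  have := continuous_capRadius (s := s) (R := R)
  unfold fiberCoord
  refine (by fun_prop : Continuous fun p : EuclideanSpace ℝ (Fin 6) =>
    max (capRadius s R p) (1 / 2 - p 5) / √η).smul ?_
  fun_prop

include hs0 hs1 hR hη hH in
theorem continuousOn_baseCoord : ContinuousOn (baseCoord s R) (capBundle s R η H) := by
  have := continuous_capRadius (s := s) (R := R)
  have h1 : Continuous (capScale s R) := by
    unfold capScale
    fun_prop
  have h2 : Continuous fun p : EuclideanSpace ℝ (Fin 6) =>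
      (!₂[p 0, p 1] : EuclideanSpace ℝ (Fin 2)) := by fun_prop
  exact (h1.continuousOn.inv₀ fun p hp => (capBundle_facts hs0 hs1 hR hη hH hp).2.2.2.1.ne').smul
    h2.continuousOn

/-- The bundle over the cap is a handle. -/
def handleHomeomorph (hs0 : 0 < s) (hs1 : s < 1) (hR : 0 < R) (hη : 0 < η) (hH : IsRayProfile H) :
    capBundle s R η H ≃ₜ Disk × Disk :=
  haveI : CompactSpace (capBundle s R η H) :=
    isCompact_iff_compactSpace.1 (isCompact_capBundle hη.le hH)
  Continuous.homeoOfEquivCompactToT2 (f := Equiv.ofBijective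
    (fun p : capBundle s R η H => ((⟨fiberCoord s R η p, mem_closedBall_zero_iff.2
      (norm_fiberCoord_le hs0 hs1 hR hη hH p.2)⟩, ⟨baseCoord s R p, mem_closedBall_zero_iff.2
      (norm_baseCoord_le hs0 hs1 hR hη hH p.2)⟩) : Disk × Disk))
    ⟨fun p q hpq => by
      obtain ⟨ha, hb⟩ := Prod.ext_iff.1 hpq
      have ha' : fiberCoord s R η p = fiberCoord s R η q := congrArg Subtype.val ha
      have hb' : baseCoord s R p = baseCoord s R q := congrArg Subtype.val hb
      obtain ⟨hx, h0, h1, h2, h5⟩ :=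
        capRadius_eq_of_baseCoord_eq hs0 hs1 hR hη hH p.2 q.2 hb' (by rw [ha'])
      have hm := (capBundle_facts hs0 hs1 hR hη hH p.2).2.2.1
      have hsm : (!₂[p.1 3, p.1 4] : EuclideanSpace ℝ (Fin 2)) = !₂[q.1 3, q.1 4] := by
        rw [fiberCoord, fiberCoord, ← hx, ← h5] at ha'
        exact smul_right_injective _ (div_pos hm (Real.sqrt_pos.2 hη)).ne' ha'
      have h3 : p.1 3 = q.1 3 := by simpa using congrArg (fun v => v 0) hsm
      have h4 : p.1 4 = q.1 4 := by simpa using congrArg (fun v => v 1) hsm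
      ext i
      fin_cases i
      exacts [h0, h1, h2, h3, h4, h5],
    fun ⟨a, b⟩ => by
      obtain ⟨p, hp, h1, h2⟩ := exists_mem_capBundle hs0 hs1 hR hη hH
        (mem_closedBall_zero_iff.1 a.2) (mem_closedBall_zero_iff.1 b.2)
      exact ⟨⟨p, hp⟩, Prod.ext (Subtype.ext h1) (Subtype.ext h2)⟩⟩)
    (((continuous_fiberCoord.comp continuous_subtype_val).subtype_mk _).prodMk
      ((continuousOn_iff_continuous_domRestrict.1
      (continuousOn_baseCoord hs0 hs1 hR hη hH)).subtype_mk _))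

theorem handleHomeomorph_apply (p : capBundle s R η H) :
    ((handleHomeomorph hs0 hs1 hR hη hH p).1 : EuclideanSpace ℝ (Fin 2)) = fiberCoord s R η p ∧
    ((handleHomeomorph hs0 hs1 hR hη hH p).2 : EuclideanSpace ℝ (Fin 2)) = baseCoord s R p :=
  ⟨rfl, rfl⟩

theorem isTwoHandleOverCap_of_eq {θ₀ : ℝ} {X : Set (EuclideanSpace ℝ (Fin 6))}
    (hs0 : 0 < s) (hs1 : s < 1) (hR : 0 < R) (hη : 0 < η) (hH : IsRayProfile H)
    (hX : overCap θ₀ (1 / 2) X = capBundle s R η H)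
    (hlat : ∀ p ∈ capBundle s R η H, latitude p = θ₀ ↔ p 2 = s * R) :
    IsTwoHandleOverCap θ₀ (1 / 2) η X := by
  rw [IsTwoHandleOverCap, hX]
  set Ψ := handleHomeomorph hs0 hs1 hR hη hH
  have key : ∀ a b : Disk, fiberCoord s R η (Ψ.symm (a, b)) = a.1 ∧
      baseCoord s R (Ψ.symm (a, b)) = b.1 := by
    intro a b
    obtain ⟨h1, h2⟩ := handleHomeomorph_apply hs0 hs1 hR hη hH (Ψ.symm (a, b))
    rw [← h1, ← h2]
    change (Ψ (Ψ.symm (a, b))).1.1 = a.1 ∧ (Ψ (Ψ.symm (a, b))).2.1 = b.1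
    rw [Ψ.apply_symm_apply]
    exact ⟨rfl, rfl⟩
  have hone : ∀ p ∈ capBundle s R η H, ‖fiberCoord s R η p‖ = 1 ↔
      capRadius s R p = 1 ∨ 1 / 2 - p 5 = 1 := by
    intro p hp
    obtain ⟨hx0, hx1, -⟩ := capRadius_mem hs1 hR hp
    rw [← hH.max_sq_mul_eq_one_iff hx0 hx1 (by linarith [hp.2.2.2.1]), ← norm_sq_fiberCoord hη hp,
      pow_eq_one_iff_of_nonneg (norm_nonneg _) two_ne_zero]
  refine ⟨Ψ.symm, ?_, ?_, ?_, ?_⟩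
  · intro a b
    have hp := (Ψ.symm (a, b)).2
    rw [← (key a b).1, hone _ hp, hlat _ hp, or_comm]
    have h1s : 1 - s ≠ 0 := by linarith
    refine or_congr ⟨fun h => by linarith, fun h => by linarith⟩ ?_
    rw [capRadius, div_eq_one_iff_eq h1s, sub_right_inj, div_eq_iff hR.ne']
  · intro a b
    have hp := (Ψ.symm (a, b)).2
    have h1 := norm_sq_baseCoord hs0 hs1 hR hη hH hp
    have h2 := (capBundle_facts hs0 hs1 hR hη hH hp).2.1
    rw [(key a b).2] at h1
    constructor
    · intro h
      rw [h] at h1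
      linarith
    · intro h
      have h3 : ‖b.1‖ ^ 2 = 1 := by
        rw [h, sub_self, add_zero] at h1 h2
        exact (mul_right_cancel₀ h2.ne' ((one_mul _).trans h1)).symm
      exact (pow_eq_one_iff_of_nonneg (norm_nonneg _) two_ne_zero).1 h3
  · intro a b ha
    have hp := (Ψ.symm (a, b)).2
    obtain ⟨hx0, hx1, -⟩ := capRadius_mem hs1 hR hp
    have h1 := (key a b).1
    rw [← h1, hone _ hp] at ha
    -- On the attaching part the weight max(x, y) is 1, so (u, w) = √η a, as the product framing
    -- requires.
    have hm : max (capRadius s R (Ψ.symm (a, b)).1) (1 / 2 - (Ψ.symm (a, b)).1 5) = 1 := by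
      rcases ha with h | h
      · rw [h, max_eq_left]
        linarith [hp.2.2.2.1]
      · rw [h, max_eq_right hx1]
    have hη' := Real.sqrt_pos.2 hη
    rw [fiberCoord, hm] at h1
    rw [← h1]
    constructor <;> simp <;> field_simp
  · intro a a' b ha ha' i h3 h4
    obtain ⟨-, e0, e1, e2, e5⟩ := capRadius_eq_of_baseCoord_eq hs0 hs1 hR hη hH
      (Ψ.symm (a, b)).2 (Ψ.symm (a', b)).2 (by rw [(key a b).2, (key a' b).2])
      (by rw [(key a b).1, (key a' b).1, ha, ha'])
    fin_cases i
    exacts [e0, e1, e2, absurd rfl h3, absurd rfl h4, e5]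

end Handle

end PSCHandle

end

theorem mainTheorem3 (θ₀ : ℝ) (hθ₀ : 0 < θ₀) (hθ₀' : θ₀ < Real.pi / 2) :
    ∃ R₀ : ℝ, 0 < R₀ ∧ ∀ R : ℝ, R₀ ≤ R →
      ∃ (T r₀ : ℝ) (r : ℝ → ℝ → ℝ), 0 < T ∧
        PSCHandle.BoundaryConditions θ₀ T r₀ r ∧
        PSCHandle.IsSubmanifoldWithPSC 4 (PSCHandle.cobordism R r) ∧
        PSCHandle.HasCylindricalEnds R θ₀ T r₀ (PSCHandle.cobordism R r) ∧
        PSCHandle.IsTwoHandleOverCap θ₀ T r₀ (PSCHandle.cobordism R r) := by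
  -- Any positive R₀ would do: δ and η are chosen after R.
  refine ⟨1, one_pos, fun R hR1 => ?_⟩
  have hR : 0 < R := by linarith
  have hs0 : 0 < Real.sin θ₀ := Real.sin_pos_of_pos_of_lt_pi hθ₀ (by linarith [Real.pi_pos])
  have hs1 : Real.sin θ₀ < 1 := by
    rw [← Real.sin_pi_div_two]
    exact Real.sin_lt_sin_of_lt_of_le_pi_div_two (by linarith) le_rfl hθ₀'
  obtain ⟨δ, η, hδ, hδE, hη, hpsc⟩ := PSCHandle.exists_isSubmanifoldWithPSC hs0 hs1 hR
  have hbc := PSCHandle.boundaryConditions_radiusSq hθ₀ hθ₀' hR hδ hδE hη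
  have hX := PSCHandle.cobordism_eq_circleBundle hR (PSCHandle.radiusSq (Real.sin θ₀) R δ η)
  refine ⟨1 / 2, η, _, by norm_num, hbc, ?_, PSCHandle.hasCylindricalEnds_cobordism hbc, ?_⟩
  · rw [hX]
    exact hpsc
  have hlat : ∀ p : EuclideanSpace ℝ (Fin 6), p 0 ^ 2 + p 1 ^ 2 + p 2 ^ 2 = R ^ 2 →
      (θ₀ ≤ PSCHandle.latitude p ↔ Real.sin θ₀ * R ≤ p 2) ∧
      (PSCHandle.latitude p = θ₀ ↔ p 2 = Real.sin θ₀ * R) := by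
    intro p hp
    have hmem : θ₀ ∈ Set.Icc (-(Real.pi / 2)) (Real.pi / 2) := ⟨by linarith, hθ₀'.le⟩
    have hlm := PSCHandle.latitude_mem_latitudes p
    rw [← PSCHandle.mul_sin_latitude hR hp, mul_comm R]
    constructor
    · rw [mul_le_mul_iff_left₀ hR]
      exact (Real.strictMonoOn_sin.le_iff_le hmem hlm).symm
    · rw [mul_left_inj' hR.ne']
      exact (Real.injOn_sin.eq_iff hlm hmem).symm
  refine PSCHandle.isTwoHandleOverCap_of_eq hs0 hs1 hR hη
    (PSCHandle.isRayProfile_normalizedRadiusSq hδ hδE) ?_ fun p hp => (hlat p hp.1).2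
  rw [hX]
  ext p
  simp only [PSCHandle.overCap, PSCHandle.circleBundle, PSCHandle.capBundle, Set.mem_ofPred_eq,
    PSCHandle.radiusSq_eq_normalizedRadiusSq hs1, PSCHandle.capRadius]
  constructor
  · rintro ⟨⟨h1, h2⟩, h3, h4⟩
    exact ⟨h1, h2, (hlat p h1).1.1 h3, h4⟩
  · rintro ⟨h1, h2, h3, h4⟩
    exact ⟨⟨h1, h2⟩, (hlat p h1).1.2 h3, h4⟩
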